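/- **Setting.** Let $\mathcal G=(V,E)$ be a connected simple undirected graph with $n\ge 2$ nodes and $m$ edges, $L=D-A$ its Laplacian, $B$ its (arbitrarily oriented) edge–node incidence matrix, $\Omega=(I+L)^{-1}$, and let $s\in[0,1]^V$ be the internal opinions. For $T\subseteq V$ let $s^T$ be $s$ with the entries in $T$ replaced by $0$ and $z^T=\Omega s^T$ the equilibrium opinions of the Friedkin–Johnsen model. Let $f(T)$ be either the resistance $(s^T)^\top z^T$ or the controversy $(z^T)^\top z^T$. Let $0\le k\le n$, let $T_{\rm opt}$ minimize $f$ among the $k$-element subsets of $V$, and let $0<\epsilon\le 1/2$. **Estimator.** An estimator is a randomized procedure which, given a symmetric diagonally dominant M-matrix $S\in\mathbb R^{n\times n}$ (SDDM: positive definite, nonpositive off the diagonal, nonnegative row sums), $b\in\mathbb R^n$ and $\delta>0$, returns a vector $y$. It has failure probability at most $\eta=\eta(n)\le 1$ if for each input $\|y-S^{-1}b\|_S\le\delta\|S^{-1}b\|_S$ holds with probability at least $1-\eta$, where $\|y\|_S=\sqrt{y^\top S y}$. It is nearly linear with constants $(A,a)$ if for $n\ge 2$ its expected number of steps on each input is at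 most $A\cdot{\rm nnz}(S)\,(\log n)^a$, with ${\rm nnz}(S)$ the number of nonzero entries of $S$. **Algorithm Greedy-AC.** Put $p=\lceil 24\log n/(\epsilon/12)^2\rceil$ and fix $$0<\delta_1\le\tfrac{\epsilon\sqrt{1-\epsilon/12}\,(n-1)}{32n^2(n+1)\sqrt{(1+\epsilon/12)(n+1)n}},\quad 0<\delta_2\le\tfrac{\epsilon\sqrt{1-\epsilon/12}}{32(n+1)\sqrt{(1+\epsilon/12)(n+1)n}},\quad 0<\delta_3\le\tfrac{\epsilon}{6\det(I+L)\sqrt{n(1+n)}} .$$ Start with $T=\emptyset$ and repeat $k$ times: draw fresh random matrices $P\in\mathbb R^{p\times n}$, $Q\in\mathbb R^{p\times m}$ with independent entries (uniform on $\pm1/\sqrt p$, or Gaussian $N(0,1/p)$); for each $r=1,\dots,p$ compute by calls of the estimator, with fresh independent randomness, $q\leftarrow(I+L,s,\delta_3)$, $h\leftarrow(I+L,q,\delta_3)$, the row $\tilde X_r\leftarrow(I+L,(QB)_r,\delta_1)$ and the row $\tilde Y_r\leftarrow(I+L,P_r,\delta_2)$ (so that the last $q,h$ are kept); for each node $i$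 put $\hat\Delta(i)=s_i\bigl(2q_i-(\|\tilde Xe_i\|^2+\|\tilde Ye_i\|^2)s_i\bigr)$ for resistance and $\hat\Delta(i)=s_i\bigl(2h_i-\|\tilde Ye_i\|^2s_i\bigr)$ for controversy; choose $i\in V\setminus T$ maximizing $\hat\Delta(i)$ (ties broken by an arbitrary fixed rule, which may depend on $T$), add $i$ to $T$ and set $s_i\leftarrow0$. Return $T$. **Theorem.** 1. If the estimator has failure probability at most $\eta$, then the set $T$ returned by Greedy-AC satisfies $|T|=k$ and $$f(\emptyset)-f(T)\ \ge\ \Bigl(1-\frac1e-\epsilon\Bigr)\bigl(f(\emptyset)-f(T_{\rm opt})\bigr)$$ with probability at least $\bigl(1-\frac1n\bigr)(1-\eta)^{(2p+2)k}$; that is, with probability $1-\frac1n$ up to the possible failures of the $(2p+2)k$ estimator calls whose results are used. 2. For all $A,a$ there are constants $C,c$, depending on nothing else, such that if the estimator is nearly linear with constants $(A,a)$ and $k\ge1$, then the expected running time of Greedy-AC, counted in unit-cost real arithmetic operations, comparisons, memory accesses and random draws, plus the steps of the estimator calls, and with $p,\delta_1,\delta_2,\delta_3$ given, is at most $C\,m\,k\,\epsilon^{-2}(\log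 n)^c$, i.e. $\tilde O(mk\epsilon^{-2})$. -/

import Mathlib

open MeasureTheory ProbabilityTheory
open scoped ENNReal NNReal Matrix

noncomputable section

namespace GreedyAC

/-! ### Conflict measures of the Friedkin–Johnsen model -/

/-- The two conflict measures. -/
inductive Objective where
  | resistance
  | controversy

/-- `I + L`, with `L` the graph Laplacian. -/
def shiftedLap {n : ℕ} (G : SimpleGraph (Fin n)) [DecidableRel G.Adj] :
    Matrix (Fin n) (Fin n) ℝ :=
  1 + G.lapMatrix ℝ

/-- Equilibrium expressed opinions `z = (I + L)⁻¹ s`. -/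
def equilibrium {n : ℕ} (G : SimpleGraph (Fin n)) [DecidableRel G.Adj] (s : Fin n → ℝ) :
    Fin n → ℝ :=
  (shiftedLap G)⁻¹ *ᵥ s

/-- The value of the measure at internal opinions `s`: resistance is `sᵀ z`, controversy `zᵀ z`. -/
def conflict {n : ℕ} (G : SimpleGraph (Fin n)) [DecidableRel G.Adj] (o : Objective)
    (s : Fin n → ℝ) : ℝ :=
  match o with
  | .resistance => s ⬝ᵥ equilibrium G s
  | .controversy => equilibrium G s ⬝ᵥ equilibrium G s

/-- `f(T)`: the measure after the internal opinions of the nodes of `T` have been set to `0`. -/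
def objective {n : ℕ} (G : SimpleGraph (Fin n)) [DecidableRel G.Adj] (o : Objective)
    (s : Fin n → ℝ) (T : Finset (Fin n)) : ℝ :=
  conflict G o (fun i => if i ∈ T then 0 else s i)

/-- `T` minimizes `f` among the sets of exactly `k` nodes. -/
def IsOptimal {n : ℕ} (f : Finset (Fin n) → ℝ) (k : ℕ) (T : Finset (Fin n)) : Prop :=
  T.card = k ∧ ∀ T' : Finset (Fin n), T'.card = k → f T ≤ f T'

/-- A listing of the edges of `G`, each exactly once and with an arbitrary orientation. -/
structure EdgeList {n : ℕ} (G : SimpleGraph (Fin n)) (m : ℕ) where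
  head : Fin m → Fin n
  tail : Fin m → Fin n
  adj : ∀ e, G.Adj (head e) (tail e)
  inj : Function.Injective fun e => s(head e, tail e)
  surj : ∀ i j, G.Adj i j → ∃ e, s(head e, tail e) = s(i, j)

/-! ### Step counting (real RAM with unit cost instructions) -/

/-- The result of a computation together with the number of steps it took. -/
structure Timed (α : Type) where
  val : α
  steps : ℕ

namespace Timed

instance : Monad Timed where
  pure x := ⟨x, 0⟩
  bind x f := ⟨(f x.val).val, x.steps + (f x.val).steps⟩

/-- `c` steps without a result. -/
def tick (c : ℕ) : Timed Unit := ⟨(), c⟩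

/-- One instruction: an arithmetic operation, comparison, memory access or random draw. -/
def op {α : Type} (x : α) : Timed α := ⟨x, 1⟩

/-- `for i = 0, …, N - 1` with a mutable state; one step of overhead per iteration. -/
def loop {σ : Type} (N : ℕ) (body : Fin N → σ → Timed σ) (init : σ) : Timed σ :=
  (List.finRange N).foldlM (fun st i => do tick 1; body i st) init

/-- Fill an array of length `N`: the cost of all entries, and one write for each. -/
def tabulate {α : Type} (N : ℕ) (f : Fin N → Timed α) : Timed (Fin N → α) :=
  ⟨fun i => (f i).val, ∑ i, ((f i).steps + 1)⟩

/-- Copy a vector. -/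
def store {N : ℕ} (v : Fin N → ℝ) : Timed (Fin N → ℝ) :=
  tabulate N fun i => op (v i)

end Timed

/-! ### Estimators for SDDM linear systems -/

/-- Symmetric, diagonally dominant M-matrices. -/
structure IsSDDM {n : ℕ} (S : Matrix (Fin n) (Fin n) ℝ) : Prop where
  posDef : S.PosDef
  offDiag : ∀ i j, i ≠ j → S i j ≤ 0
  rowSum : ∀ i, 0 ≤ ∑ j, S i j

/-- Number of nonzero entries. -/
def nnz {n : ℕ} (S : Matrix (Fin n) (Fin n) ℝ) : ℕ :=
  {x : Fin n × Fin n | S x.1 x.2 ≠ 0}.ncard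

/-- `‖y‖_S = √(yᵀ S y)`. -/
def energyNorm {n : ℕ} (S : Matrix (Fin n) (Fin n) ℝ) (y : Fin n → ℝ) : ℝ :=
  √(y ⬝ᵥ (S *ᵥ y))

universe u

/-- A randomized procedure that, given a matrix, a right-hand side, an error parameter and a
random seed, returns a vector after some number of steps. -/
structure Estimator where
  Seed : Type u
  [seedSpace : MeasurableSpace Seed]
  seedLaw : Measure Seed
  [seedProb : IsProbabilityMeasure seedLaw]
  run : {n : ℕ} → Matrix (Fin n) (Fin n) ℝ → (Fin n → ℝ) → ℝ → Seed → Timed (Fin n → ℝ)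
  measurable_val : ∀ {n : ℕ} (S : Matrix (Fin n) (Fin n) ℝ) (δ : ℝ),
    Measurable fun x : (Fin n → ℝ) × Seed => (run S x.1 δ x.2).val
  measurable_steps : ∀ {n : ℕ} (S : Matrix (Fin n) (Fin n) ℝ) (δ : ℝ),
    Measurable fun x : (Fin n → ℝ) × Seed => (run S x.1 δ x.2).steps

attribute [instance] Estimator.seedSpace Estimator.seedProb

namespace Estimator

/-- On every SDDM system of size `n` the estimator returns, with probability at least `1 - η n`, a
vector `y` with `‖y - S⁻¹ b‖_S ≤ δ ‖S⁻¹ b‖_S`. -/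
def Reliable (E : Estimator.{u}) (η : ℕ → ℝ) : Prop :=
  ∀ (n : ℕ) (S : Matrix (Fin n) (Fin n) ℝ) (b : Fin n → ℝ) (δ : ℝ), IsSDDM S → 0 < δ →
    1 - η n ≤ E.seedLaw.real
      {ω | energyNorm S ((E.run S b δ ω).val - S⁻¹ *ᵥ b) ≤ δ * energyNorm S (S⁻¹ *ᵥ b)}

/-- Expected running time `Õ(nnz)` on SDDM systems, with explicit constants. -/
def NearlyLinear (E : Estimator.{u}) (A : ℝ) (a : ℕ) : Prop :=
  ∀ (n : ℕ) (S : Matrix (Fin n) (Fin n) ℝ) (b : Fin n → ℝ) (δ : ℝ), 2 ≤ n → IsSDDM S → 0 < δ →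
    ∫⁻ ω, ((E.run S b δ ω).steps : ℝ≥0∞) ∂E.seedLaw ≤
      ENNReal.ofReal (A * nnz S * Real.log n ^ a)

end Estimator

/-! ### Random projections -/

/-- The two kinds of random projection matrices: random signs and Gaussian. -/
inductive Sketch where
  | sign
  | gaussian

/-- Law of one entry of a projection matrix with `p` rows: uniform on `±1/√p`, or `N(0, 1/p)`. -/
def Sketch.entryLaw (κ : Sketch) (p : ℕ) : Measure ℝ :=
  match κ with
  | .sign => (2⁻¹ : ℝ≥0∞) • Measure.dirac (1 / √(p : ℝ)) +
      (2⁻¹ : ℝ≥0∞) • Measure.dirac (-(1 / √(p : ℝ)))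
  | .gaussian => gaussianReal 0 (p : ℝ≥0)⁻¹

/-- Number of rows of the projection matrices. -/
def sketchDim (n : ℕ) (ε : ℝ) : ℕ :=
  ⌈24 * Real.log n / (ε / 12) ^ 2⌉₊

/-- Randomness of one call of `estimateDelta`: the entries of `P` and `Q`, and one seed for each of
the four estimator calls in each of the `p` iterations. -/
abbrev RoundTape (n m p : ℕ) (Seed : Type u) : Type u :=
  (Fin p → Fin n → ℝ) × (Fin p → Fin m → ℝ) × (Fin p → Fin 4 → Seed)

/-- All random entries and seeds of the `k` rounds are independent. -/
def tapeLaw (E : Estimator.{u}) (κ : Sketch) (n m p k : ℕ) :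
    Measure (Fin k → RoundTape n m p E.Seed) :=
  Measure.pi fun _ =>
    (Measure.pi fun _ => Measure.pi fun _ => κ.entryLaw p).prod
      ((Measure.pi fun _ => Measure.pi fun _ => κ.entryLaw p).prod
        (Measure.pi fun _ => Measure.pi fun _ => E.seedLaw))

/-! ### The algorithm -/

/-- Upper bound for the error parameter `δ₁`. -/
def delta₁Bound (n : ℕ) (ε : ℝ) : ℝ :=
  ε * √(1 - ε / 12) * (n - 1) /
    (32 * n ^ 2 * (n + 1) * √((1 + ε / 12) * (n + 1) * n))

/-- Upper bound for the error parameter `δ₂`. -/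
def delta₂Bound (n : ℕ) (ε : ℝ) : ℝ :=
  ε * √(1 - ε / 12) / (32 * (n + 1) * √((1 + ε / 12) * (n + 1) * n))

/-- Upper bound for the error parameter `δ₃`; `|I + L|` is the determinant. -/
def delta₃Bound {n : ℕ} (G : SimpleGraph (Fin n)) [DecidableRel G.Adj] (ε : ℝ) : ℝ :=
  ε / (6 * (shiftedLap G).det * √(n * (1 + n)))

/-- The error parameters are positive and below their bounds. -/
structure Precision {n : ℕ} (G : SimpleGraph (Fin n)) [DecidableRel G.Adj] (ε : ℝ) where
  δ₁ : ℝ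
  δ₂ : ℝ
  δ₃ : ℝ
  pos₁ : 0 < δ₁
  pos₂ : 0 < δ₂
  pos₃ : 0 < δ₃
  le₁ : δ₁ ≤ delta₁Bound n ε
  le₂ : δ₂ ≤ delta₂Bound n ε
  le₃ : δ₃ ≤ delta₃Bound G ε

section Algorithm

variable {n m : ℕ} {G : SimpleGraph (Fin n)}

/-- Sparse assembly of `I + L` from the edge list: `n` diagonal writes, then four entries are read,
changed and written back for each edge. -/
def assemble (edges : EdgeList G m) : Timed (Matrix (Fin n) (Fin n) ℝ) := do
  Timed.tick n
  Timed.loop m (fun e S => do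
    let i := edges.head e
    let j := edges.tail e
    Timed.tick 12
    pure (S + Matrix.single i i 1 + Matrix.single j j 1
      - Matrix.single i j 1 - Matrix.single j i 1)) 1

/-- One row of `Q B`, from the corresponding row `v` of `Q`: an edge with head `i` and tail `j` adds
its entry at `i` and subtracts it at `j`. -/
def sparseRow (edges : EdgeList G m) (v : Fin m → ℝ) : Timed (Fin n → ℝ) := do
  let zero ← Timed.tabulate n fun _ => Timed.op (0 : ℝ)
  Timed.loop m (fun e w => do
    let x ← Timed.op (v e)
    let a ← Timed.op (w (edges.head e))
    let a' ← Timed.op (a + x)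
    let w ← Timed.op (Function.update w (edges.head e) a')
    let b ← Timed.op (w (edges.tail e))
    let b' ← Timed.op (b - x)
    Timed.op (Function.update w (edges.tail e) b')) zero

/-- Squared norm of column `i` of a matrix with `p` rows. -/
def columnSq {p : ℕ} (X : Fin p → Fin n → ℝ) (i : Fin n) : Timed ℝ :=
  Timed.loop p (fun r acc => do
    let x ← Timed.op (X r i)
    let y ← Timed.op (x * x)
    Timed.op (acc + y)) 0

/-- Estimates of the marginal gains of all nodes at internal opinions `s`. -/
def estimateDelta [DecidableRel G.Adj] {ε : ℝ} (E : Estimator.{u}) (o : Objective)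
    (edges : EdgeList G m) (δ : Precision G ε) (p : ℕ) (s : Fin n → ℝ)
    (τ : RoundTape n m p E.Seed) : Timed (Fin n → ℝ) := do
  -- the scalars `δ₁`, `δ₂`, `δ₃`, `p`
  Timed.tick 4
  let S ← assemble edges
  let P ← Timed.tabulate p fun r => Timed.tabulate n fun i => Timed.op (τ.1 r i)
  let Q ← Timed.tabulate p fun r => Timed.tabulate m fun e => Timed.op (τ.2.1 r e)
  let QB ← Timed.tabulate p fun r => sparseRow edges (Q r)
  let (q, h, X, Y) ← Timed.loop p
    (fun r (st : (Fin n → ℝ) × (Fin n → ℝ) × (Fin p → Fin n → ℝ) × (Fin p → Fin n → ℝ)) => do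
      let q ← E.run S s δ.δ₃ (τ.2.2 r 0)
      let q ← Timed.store q
      let h ← E.run S q δ.δ₃ (τ.2.2 r 1)
      let h ← Timed.store h
      let x ← E.run S (QB r) δ.δ₁ (τ.2.2 r 2)
      let x ← Timed.store x
      let y ← E.run S (P r) δ.δ₂ (τ.2.2 r 3)
      let y ← Timed.store y
      pure (q, h, Function.update st.2.2.1 r x, Function.update st.2.2.2 r y))
    (0, 0, 0, 0)
  Timed.tabulate n fun i => do
    let x ← columnSq X i
    let y ← columnSq Y i
    -- memory accesses and arithmetic of the two formulas
    Timed.tick 16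
    let gainI := s i * (2 * q i - (x + y) * s i)
    let gainC := s i * (2 * h i - y * s i)
    match o with
    | .resistance => pure gainI
    | .controversy => pure gainC

/-- A node outside `T` with the largest value of `d`, by a linear scan; equal values are resolved by
the rule `tie`. -/
def argmaxOutside (tie : Finset (Fin n) → Fin n → Fin n → Bool) (T : Finset (Fin n))
    (d : Fin n → ℝ) : Timed (Option (Fin n)) :=
  Timed.loop n (fun i best => do
    -- membership in `T` is read from a bit array
    Timed.tick 1
    if i ∈ T then pure best
    else match best with
      | none => Timed.op (some i)
      | some j => do
        Timed.tick 5
        if d j < d i ∨ (d j = d i ∧ tie T j i = true) then pure (some i) else pure (some j)) none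

/-- Greedy-AC, run on the random tape `τ`. -/
def greedyAC [DecidableRel G.Adj] {ε : ℝ} (E : Estimator.{u}) (o : Objective)
    (tie : Finset (Fin n) → Fin n → Fin n → Bool) (edges : EdgeList G m) (δ : Precision G ε)
    (s : Fin n → ℝ) (k : ℕ) (τ : Fin k → RoundTape n m (sketchDim n ε) E.Seed) :
    Timed (Finset (Fin n)) := do
  -- initialization of the bit array for `T` and of the working copy of `s`
  Timed.tick (2 * n)
  let out ← Timed.loop k (fun t (st : Finset (Fin n) × (Fin n → ℝ)) => do
    let (T, s) := st
    let d ← estimateDelta E o edges δ (sketchDim n ε) s (τ t)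
    let best ← argmaxOutside tie T d
    match best with
    | none => pure (T, s)
    | some i => do
      let T ← Timed.op (insert i T)
      let s ← Timed.op (Function.update s i 0)
      pure (T, s)) (∅, s)
  pure out.1

end Algorithm

end GreedyAC

end

/-!
With `Ω = (I + L)⁻¹`, the objective is `T ↦ s^T ⬝ M s^T` for `M = Ω` or `M = Ω²`. As `I + L` is an
M-matrix, `M` is symmetric with nonnegative entries, so the objective is decreasing and supermodular
in `T`, and greedy selection by marginal gains that are known up to a factor `1 ± ε / 2` loses at
most `1 / e + ε` of the best possible decrease.

The gain of `i` needs `Ω s`, `Ω² s` and the diagonal entries `(Ω²)ᵢᵢ = ‖Ω eᵢ‖²` and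
`Ωᵢᵢ = ‖B Ω eᵢ‖² + ‖Ω eᵢ‖²`. The norms are estimated by random projections, which by the
Johnson–Lindenstrauss lemma fail in a given round with probability at most `1 / n²`. Solver errors
become relative errors because the entries of `Ω` are bounded below: the adjugate of `I + L` is an
integer matrix with, on a connected graph, positive entries, so every entry of `Ω` is at least
`1 / det (I + L)`. As the rounds are independent, all of the at most `n` rounds are accurate with
the claimed probability.

Linearity of expectation gives the running time, since `I + L` has at most `n + 2 m` nonzero entries
and `n ≤ m + 1` on a connected graph.
-/

noncomputable section

namespace GreedyAC

universe u

namespace Timed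

variable {α β σ : Type}

@[simp] lemma val_pure (x : α) : (pure x : Timed α).val = x := rfl

@[simp] lemma steps_pure (x : α) : (pure x : Timed α).steps = 0 := rfl

@[simp] lemma val_bind (x : Timed α) (f : α → Timed β) : (x >>= f).val = (f x.val).val := rfl

@[simp] lemma steps_bind (x : Timed α) (f : α → Timed β) :
    (x >>= f).steps = x.steps + (f x.val).steps := rfl

@[simp] lemma steps_tick (c : ℕ) : (tick c).steps = c := rfl

@[simp] lemma val_op (x : α) : (op x).val = x := rfl

@[simp] lemma steps_op (x : α) : (op x).steps = 1 := rfl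

@[simp] lemma val_tabulate (N : ℕ) (f : Fin N → Timed α) :
    (tabulate N f).val = fun i => (f i).val := rfl

@[simp] lemma steps_tabulate (N : ℕ) (f : Fin N → Timed α) :
    (tabulate N f).steps = ∑ i, ((f i).steps + 1) := rfl

@[simp] lemma val_store {N : ℕ} (v : Fin N → ℝ) : (store v).val = v := rfl

@[simp] lemma steps_store {N : ℕ} (v : Fin N → ℝ) : (store v).steps = 2 * N := by
  simp [store, mul_comm]

lemma loop_zero (body : Fin 0 → σ → Timed σ) (init : σ) : loop 0 body init = pure init := rfl

lemma loop_succ (N : ℕ) (body : Fin (N + 1) → σ → Timed σ) (init : σ) :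
    loop (N + 1) body init =
      (do tick 1; body 0 init) >>= loop N fun i => body i.succ := by
  simp only [loop, List.finRange_succ, List.foldlM_cons, List.foldlM_map]
  rfl

lemma val_loop_succ (N : ℕ) (body : Fin (N + 1) → σ → Timed σ) (init : σ) :
    (loop (N + 1) body init).val = (loop N (fun i => body i.succ) (body 0 init).val).val := by
  rw [loop_succ]; rfl

lemma steps_loop_succ (N : ℕ) (body : Fin (N + 1) → σ → Timed σ) (init : σ) :
    (loop (N + 1) body init).steps =
      1 + (body 0 init).steps + (loop N (fun i => body i.succ) (body 0 init).val).steps := by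
  rw [loop_succ]; rfl

lemma val_loop_induction {N : ℕ} {body : Fin N → σ → Timed σ} {init : σ} (M : ℕ → σ → Prop)
    (zero : M 0 init) (succ : ∀ (i : Fin N) st, M i st → M (i + 1) (body i st).val) :
    M N (loop N body init).val := by
  induction N generalizing init M with
  | zero => exact zero
  | succ N ih =>
    rw [val_loop_succ]
    exact ih (fun j => M (j + 1)) (by simpa using succ 0 init zero)
      fun i st hi => by simpa using succ i.succ st (by simpa using hi)

lemma val_loop_eq_add_sum {M : Type} [AddCommMonoid M] {N : ℕ} {body : Fin N → M → Timed M}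
    {f : Fin N → M} (h : ∀ i x, (body i x).val = x + f i) (init : M) :
    (loop N body init).val = init + ∑ i, f i := by
  induction N generalizing init with
  | zero => simp [loop_zero]
  | succ N ih => rw [val_loop_succ, ih fun i => h i.succ, h, Fin.sum_univ_succ, add_assoc]

lemma steps_loop_eq_sum {N : ℕ} {body : Fin N → σ → Timed σ} {c : Fin N → ℕ}
    (h : ∀ i st, (body i st).steps = c i) (init : σ) :
    (loop N body init).steps = ∑ i, (1 + c i) := by
  induction N generalizing init with
  | zero => rfl
  | succ N ih => rw [steps_loop_succ, ih fun i => h i.succ, h, Fin.sum_univ_succ]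

lemma steps_loop_le {N c : ℕ} {body : Fin N → σ → Timed σ}
    (h : ∀ i st, (body i st).steps ≤ c) (init : σ) :
    (loop N body init).steps ≤ N * (1 + c) := by
  induction N generalizing init with
  | zero => simp [loop_zero]
  | succ N ih =>
    rw [steps_loop_succ, add_mul, one_mul, add_comm]
    exact add_le_add (ih (fun i => h i.succ) _) (by gcongr; exact h 0 init)

end Timed

section Subroutines

variable {n m : ℕ} {G : SimpleGraph (Fin n)} (edges : EdgeList G m)

/-- The edge–node incidence matrix `B`: the row of an edge is `1` at its head and `-1` at its
tail. -/
def incidence : Matrix (Fin m) (Fin n) ℝ :=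
  .of fun e => Pi.single (edges.head e) 1 - Pi.single (edges.tail e) 1

lemma incidence_row (e : Fin m) :
    incidence edges e = Pi.single (edges.head e) 1 - Pi.single (edges.tail e) 1 := rfl

lemma vecMul_incidence (v : Fin m → ℝ) :
    v ᵥ* incidence edges =
      ∑ e, (Pi.single (edges.head e) (v e) - Pi.single (edges.tail e) (v e)) := by
  refine (Matrix.vecMul_eq_sum v _).trans (Finset.sum_congr rfl fun e _ => ?_)
  simp [incidence_row, smul_sub, ← Pi.single_smul]

lemma sum_ite_edge_eq [DecidableRel G.Adj] (i j : Fin n) :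
    (∑ e, if s(edges.head e, edges.tail e) = s(i, j) then (1 : ℝ) else 0) =
      if G.Adj i j then 1 else 0 := by
  split_ifs with h
  · obtain ⟨e, he⟩ := edges.surj i j h
    rw [Finset.sum_eq_single e (fun e' _ hne => if_neg fun he' => hne ?_) (by simp), if_pos he]
    exact edges.inj (he'.trans he.symm)
  · refine Finset.sum_eq_zero fun e _ => if_neg fun he => h ?_
    rw [← SimpleGraph.mem_edgeSet, ← he]
    exact edges.adj e

lemma incidence_mulVec_one : incidence edges *ᵥ 1 = 0 := by
  ext e
  simp [incidence, Matrix.mulVec, dotProduct]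

lemma incidence_mul_incidence_of_ne {i j : Fin n} (hij : i ≠ j) (e : Fin m) :
    incidence edges e i * incidence edges e j =
      -if s(edges.head e, edges.tail e) = s(i, j) then 1 else 0 := by
  have hne : edges.head e ≠ edges.tail e := (edges.adj e).ne
  simp only [incidence, Matrix.of_apply, Pi.sub_apply, Pi.single_apply, Sym2.eq_iff]
  grind

lemma eq_of_mulVec_one_eq_of_offDiag_eq {ι : Type*} [Fintype ι] {M N : Matrix ι ι ℝ}
    (h : M *ᵥ 1 = N *ᵥ 1) (hoff : ∀ i j, i ≠ j → M i j = N i j) : M = N := by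
  classical
  ext i j
  rcases ne_or_eq i j with hij | rfl
  · exact hoff i j hij
  · have hrow : ∑ j, M i j = ∑ j, N i j := by
      simpa [Matrix.mulVec, dotProduct] using congrFun h i
    have herase : ∑ j ∈ Finset.univ.erase i, M i j = ∑ j ∈ Finset.univ.erase i, N i j :=
      Finset.sum_congr rfl fun j hj => hoff i j (Finset.ne_of_mem_erase hj).symm
    rw [← Finset.add_sum_erase _ _ (Finset.mem_univ i),
      ← Finset.add_sum_erase _ _ (Finset.mem_univ i), herase] at hrow
    exact add_right_cancel hrow

lemma transpose_incidence_mul_incidence [DecidableRel G.Adj] :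
    (incidence edges)ᵀ * incidence edges = G.lapMatrix ℝ := by
  refine eq_of_mulVec_one_eq_of_offDiag_eq ?_ fun i j hij => ?_
  · rw [← Matrix.mulVec_mulVec, incidence_mulVec_one, Matrix.mulVec_zero]
    exact (SimpleGraph.lapMatrix_mulVec_const_eq_zero G).symm
  · simp only [Matrix.mul_apply, Matrix.transpose_apply,
      incidence_mul_incidence_of_ne edges hij, Finset.sum_neg_distrib, sum_ite_edge_eq]
    simp [SimpleGraph.lapMatrix, SimpleGraph.degMatrix, Matrix.diagonal_apply_ne _ hij]

lemma vecMulVec_incidence (e : Fin m) :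
    Matrix.vecMulVec (incidence edges e) (incidence edges e) =
      Matrix.single (edges.head e) (edges.head e) 1 + Matrix.single (edges.tail e) (edges.tail e) 1
        - Matrix.single (edges.head e) (edges.tail e) 1
        - Matrix.single (edges.tail e) (edges.head e) 1 := by
  simp only [incidence_row, Matrix.sub_vecMulVec, Matrix.vecMulVec_sub,
    ← Matrix.single_eq_single_vecMulVec_single]
  abel

lemma val_assemble [DecidableRel G.Adj] : (assemble edges).val = shiftedLap G := by
  have sum_vecMulVec : G.lapMatrix ℝ =
      ∑ e, Matrix.vecMulVec (incidence edges e) (incidence edges e) := by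
    ext i j
    simp [← transpose_incidence_mul_incidence edges, Matrix.mul_apply, Matrix.sum_apply,
      Matrix.vecMulVec_apply]
  rw [shiftedLap, sum_vecMulVec]
  refine Timed.val_loop_eq_add_sum (fun e S => ?_) 1
  rw [vecMulVec_incidence]
  simp only [Timed.val_bind, Timed.val_pure]
  abel

lemma steps_assemble : (assemble edges).steps = n + 13 * m := by
  rw [assemble, Timed.steps_bind, Timed.steps_loop_eq_sum (c := fun _ => 12) fun _ _ => rfl]
  simp [mul_comm]

lemma update_update_eq_add {ι : Type*} [DecidableEq ι] (w : ι → ℝ) (i j : ι) (x : ℝ) :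
    Function.update (Function.update w i (w i + x)) j (Function.update w i (w i + x) j - x) =
      w + (Pi.single i x - Pi.single j x) := by
  ext l
  simp only [Function.update_apply, Pi.add_apply, Pi.sub_apply, Pi.single_apply]
  grind

lemma val_sparseRow (v : Fin m → ℝ) : (sparseRow edges v).val = v ᵥ* incidence edges := by
  rw [vecMul_incidence, ← zero_add (∑ e, _)]
  exact Timed.val_loop_eq_add_sum (fun e w => update_update_eq_add w _ _ (v e)) 0

lemma steps_sparseRow (v : Fin m → ℝ) : (sparseRow edges v).steps = 2 * n + 8 * m := by
  rw [sparseRow, Timed.steps_bind, Timed.steps_loop_eq_sum (c := fun _ => 7) fun _ _ => rfl]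
  simp [mul_comm]

lemma val_columnSq {p : ℕ} (X : Fin p → Fin n → ℝ) (i : Fin n) :
    (columnSq X i).val = ∑ r, X r i ^ 2 := by
  rw [columnSq, Timed.val_loop_eq_add_sum (f := fun r => X r i ^ 2) fun r x => ?_, zero_add]
  simp [pow_two]

lemma steps_columnSq {p : ℕ} (X : Fin p → Fin n → ℝ) (i : Fin n) :
    (columnSq X i).steps = 4 * p := by
  rw [columnSq, Timed.steps_loop_eq_sum (c := fun _ => 3) fun _ _ => rfl]
  simp [mul_comm]

/-- The invariant of the linear scan in `argmaxOutside`, after the nodes `j < N`: `none` if all of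
them lie in `T`, otherwise one of those outside `T` with the largest value of `d`. -/
def IsMaxOutside (T : Finset (Fin n)) (d : Fin n → ℝ) (N : ℕ) : Option (Fin n) → Prop
  | none => ∀ j : Fin n, j < N → j ∈ T
  | some i => i ∉ T ∧ ∀ j : Fin n, j < N → j ∉ T → d j ≤ d i

lemma isMaxOutside_val_argmaxOutside (tie : Finset (Fin n) → Fin n → Fin n → Bool)
    (T : Finset (Fin n)) (d : Fin n → ℝ) : IsMaxOutside T d n (argmaxOutside tie T d).val := by
  refine Timed.val_loop_induction (IsMaxOutside T d) (fun j hj => absurd hj (by simp)) ?_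
  intro i best h
  have lt_succ (j : Fin n) : (j : ℕ) < i + 1 ↔ (j : ℕ) < i ∨ j = i := by
    rw [Nat.lt_succ_iff_lt_or_eq, Fin.ext_iff]
  cases best with
  | none =>
    rw [Timed.val_bind]
    split_ifs <;> simp only [IsMaxOutside, Timed.val_pure, Timed.val_op, lt_succ] at * <;> grind
  | some b =>
    rw [Timed.val_bind]
    split_ifs with hi
    · simp only [IsMaxOutside, Timed.val_pure, lt_succ] at *
      grind
    · rw [Timed.val_bind]
      split_ifs <;> simp only [IsMaxOutside, Timed.val_pure, lt_succ] at * <;> grind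

lemma exists_val_argmaxOutside_eq_some (tie : Finset (Fin n) → Fin n → Fin n → Bool)
    {T : Finset (Fin n)} (d : Fin n → ℝ) (hT : T.card < n) :
    ∃ i, (argmaxOutside tie T d).val = some i ∧ i ∉ T ∧ ∀ j ∉ T, d j ≤ d i := by
  have h := isMaxOutside_val_argmaxOutside tie T d
  cases hv : (argmaxOutside tie T d).val with
  | none =>
    rw [hv] at h
    have : T = Finset.univ := Finset.eq_univ_iff_forall.mpr fun j => h j j.isLt
    simp [this] at hT
  | some i =>
    rw [hv] at h
    exact ⟨i, rfl, h.1, fun j hj => h.2 j j.isLt hj⟩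

lemma steps_argmaxOutside_le (tie : Finset (Fin n) → Fin n → Fin n → Bool) (T : Finset (Fin n))
    (d : Fin n → ℝ) : (argmaxOutside tie T d).steps ≤ n * 7 := by
  refine Timed.steps_loop_le (c := 6) (fun i best => ?_) none
  cases best <;> simp only [Timed.steps_bind, Timed.steps_tick] <;> split_ifs <;> simp

end Subroutines

section Round

variable {n m p : ℕ} {G : SimpleGraph (Fin n)} [DecidableRel G.Adj] {ε : ℝ} (E : Estimator.{u})
  (o : Objective) (edges : EdgeList G m) (δ : Precision G ε) (s : Fin n → ℝ)
  (τ : RoundTape n m p E.Seed)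

/-- The estimator call of iteration `r` that computes `q`, an estimate of `(I + L)⁻¹ s`. -/
def solveQ (r : Fin p) : Timed (Fin n → ℝ) :=
  E.run (shiftedLap G) s δ.δ₃ (τ.2.2 r 0)

/-- The estimator call of iteration `r` that computes `h`, an estimate of `(I + L)⁻² s`. -/
def solveH (r : Fin p) : Timed (Fin n → ℝ) :=
  E.run (shiftedLap G) (solveQ E δ s τ r).val δ.δ₃ (τ.2.2 r 1)

/-- The estimator call that computes row `r` of `X̃`, an estimate of `Q B (I + L)⁻¹`. -/
def solveX (r : Fin p) : Timed (Fin n → ℝ) :=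
  E.run (shiftedLap G) (τ.2.1 r ᵥ* incidence edges) δ.δ₁ (τ.2.2 r 2)

/-- The estimator call that computes row `r` of `Ỹ`, an estimate of `P (I + L)⁻¹`. -/
def solveY (r : Fin p) : Timed (Fin n → ℝ) :=
  E.run (shiftedLap G) (τ.1 r) δ.δ₂ (τ.2.2 r 3)

/-- The number of steps of the four estimator calls of iteration `r`. -/
def solveSteps (r : Fin p) : ℕ :=
  (solveQ E δ s τ r).steps + (solveH E δ s τ r).steps + (solveX E edges δ τ r).steps +
    (solveY E δ τ r).steps

/-- The loop variables `(q, h, X̃, Ỹ)` of `estimateDelta`. -/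
abbrev SolveState (n p : ℕ) : Type :=
  (Fin n → ℝ) × (Fin n → ℝ) × (Fin p → Fin n → ℝ) × (Fin p → Fin n → ℝ)

/-- The loop body of `estimateDelta`, with the values of `assemble` and `sparseRow` inserted. -/
def solveBody (r : Fin p) (st : SolveState n p) : Timed (SolveState n p) := do
  let q ← E.run (shiftedLap G) s δ.δ₃ (τ.2.2 r 0)
  let q ← Timed.store q
  let h ← E.run (shiftedLap G) q δ.δ₃ (τ.2.2 r 1)
  let h ← Timed.store h
  let x ← E.run (shiftedLap G) (τ.2.1 r ᵥ* incidence edges) δ.δ₁ (τ.2.2 r 2)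
  let x ← Timed.store x
  let y ← E.run (shiftedLap G) (τ.1 r) δ.δ₂ (τ.2.2 r 3)
  let y ← Timed.store y
  pure (q, h, Function.update st.2.2.1 r x, Function.update st.2.2.2 r y)

lemma val_solveBody (r : Fin p) (st : SolveState n p) :
    (solveBody E edges δ s τ r st).val =
      ((solveQ E δ s τ r).val, (solveH E δ s τ r).val,
        Function.update st.2.2.1 r (solveX E edges δ τ r).val,
        Function.update st.2.2.2 r (solveY E δ τ r).val) := rfl

lemma steps_solveBody (r : Fin p) (st : SolveState n p) :
    (solveBody E edges δ s τ r st).steps = solveSteps E edges δ s τ r + 8 * n := by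
  simp only [solveBody, solveSteps, solveQ, solveH, solveX, solveY, Timed.steps_bind,
    Timed.val_store, Timed.steps_store, Timed.steps_pure]
  ring

lemma val_loop_solveBody {r : Fin p} (hr : (r : ℕ) + 1 = p) (init : SolveState n p) :
    (Timed.loop p (solveBody E edges δ s τ) init).val =
      ((solveQ E δ s τ r).val, (solveH E δ s τ r).val,
        fun r => (solveX E edges δ τ r).val, fun r => (solveY E δ τ r).val) := by
  have hinv := Timed.val_loop_induction (body := solveBody E edges δ s τ) (init := init)
    (fun N st =>
      (∀ j : Fin p, (j : ℕ) + 1 = N → st.1 = (solveQ E δ s τ j).val ∧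
        st.2.1 = (solveH E δ s τ j).val) ∧
      ∀ j : Fin p, j < N → st.2.2.1 j = (solveX E edges δ τ j).val ∧
        st.2.2.2 j = (solveY E δ τ j).val)
    ⟨fun _ h => by simp at h, fun _ h => by simp at h⟩ ?_
  · obtain ⟨hlast, hrows⟩ := hinv
    exact Prod.ext (hlast r hr).1 (Prod.ext (hlast r hr).2 (Prod.ext
      (funext fun j => (hrows j j.isLt).1) (funext fun j => (hrows j j.isLt).2)))
  · refine fun i st ⟨_, hst⟩ => ⟨fun j hj => ?_, fun j hj => ?_⟩ <;> rw [val_solveBody]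
    · obtain rfl : j = i := Fin.ext (by omega)
      exact ⟨rfl, rfl⟩
    · rcases eq_or_ne j i with rfl | hne
      · simp only [Function.update_self, and_self]
      · simp only [Function.update_of_ne hne]
        exact hst j (lt_of_le_of_ne (Nat.lt_succ_iff.mp hj) (Fin.val_ne_of_ne hne))

/-- The estimate, from iteration `r`, of the vector `M s`, where the conflict measure is
`sᵀ M s`. -/
def potentialEst (r : Fin p) : Fin n → ℝ :=
  match o with
  | .resistance => (solveQ E δ s τ r).val
  | .controversy => (solveH E δ s τ r).val

/-- The estimate of the diagonal of `M`, where the conflict measure is `sᵀ M s`, by squared norms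
of the columns of `X̃` and `Ỹ`. -/
def diagEst (i : Fin n) : ℝ :=
  match o with
  | .resistance => ∑ r, (solveX E edges δ τ r).val i ^ 2 + ∑ r, (solveY E δ τ r).val i ^ 2
  | .controversy => ∑ r, (solveY E δ τ r).val i ^ 2

lemma val_estimateDelta {r : Fin p} (hr : (r : ℕ) + 1 = p) (i : Fin n) :
    (estimateDelta E o edges δ p s τ).val i =
      s i * (2 * potentialEst E o δ s τ r i - diagEst E o edges δ τ i * s i) := by
  have hloop := val_loop_solveBody E edges δ s τ hr (0, 0, 0, 0)
  unfold solveBody at hloop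
  simp only [estimateDelta, Timed.val_bind, Timed.val_tabulate, Timed.val_op, val_assemble,
    val_sparseRow]
  rw [hloop]
  cases o <;> simp only [val_columnSq, potentialEst, diagEst, Timed.val_pure]

lemma steps_estimateDelta :
    (estimateDelta E o edges δ p s τ).steps =
      4 + 18 * n + 13 * m + p * (20 * n + 10 * m + 4) + ∑ r, solveSteps E edges δ s τ r := by
  have hloop := Timed.steps_loop_eq_sum (steps_solveBody E edges δ s τ) (0, 0, 0, 0)
  unfold solveBody at hloop
  simp only [estimateDelta, Timed.val_tabulate, Timed.val_op, val_assemble,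
    val_sparseRow, Timed.steps_bind, Timed.steps_tick, Timed.steps_tabulate, Timed.steps_op,
    steps_assemble, steps_sparseRow]
  rw [hloop]
  cases o <;>
  · simp only [steps_columnSq, Timed.steps_pure, Finset.sum_add_distrib, Finset.sum_const,
      Finset.card_univ, Fintype.card_fin, smul_eq_mul]
    ring

end Round

/-! ### Inverses of M-matrices -/

section MMatrix

variable {ι : Type*} [Fintype ι] {S : Matrix ι ι ℝ}

lemma nonneg_of_mulVec_nonneg (hS : S.PosDef) (hoff : ∀ i j, i ≠ j → S i j ≤ 0) {x : ι → ℝ}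
    (hx : 0 ≤ S *ᵥ x) : 0 ≤ x := by
  rw [← negPart_eq_zero]
  by_contra hne
  have mixed_nonpos : x⁻ ⬝ᵥ (S *ᵥ x⁺) ≤ 0 := by
    simp only [dotProduct, Matrix.mulVec, Finset.mul_sum]
    refine Finset.sum_nonpos fun i _ => Finset.sum_nonpos fun j _ => ?_
    rcases eq_or_ne i j with rfl | hij
    · rcases le_total 0 (x i) with h | h <;> simp [Pi.negPart_apply, Pi.posPart_apply, h]
    · exact mul_nonpos_of_nonneg_of_nonpos (negPart_nonneg x i)
        (mul_nonpos_of_nonpos_of_nonneg (hoff i j hij) (posPart_nonneg x j))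
  have energy_pos : 0 < x⁻ ⬝ᵥ (S *ᵥ x⁻) := by simpa using hS.dotProduct_mulVec_pos hne
  have split : x⁻ ⬝ᵥ (S *ᵥ x) = x⁻ ⬝ᵥ (S *ᵥ x⁺) - x⁻ ⬝ᵥ (S *ᵥ x⁻) := by
    rw [← dotProduct_sub, ← Matrix.mulVec_sub, posPart_sub_negPart]
  linarith [dotProduct_nonneg_of_nonneg (negPart_nonneg x) hx]

lemma apply_eq_zero_of_mulVec_nonneg (hoff : ∀ i j, i ≠ j → S i j ≤ 0) {x : ι → ℝ} (hx : 0 ≤ x)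
    {i j : ι} (hSx : 0 ≤ (S *ᵥ x) i) (hi : x i = 0) (hij : S i j < 0) : x j = 0 := by
  have term_nonpos (l : ι) : S i l * x l ≤ 0 := by
    rcases eq_or_ne i l with rfl | hil
    · rw [hi, mul_zero]
    · exact mul_nonpos_of_nonpos_of_nonneg (hoff i l hil) (hx l)
  have sum_zero : ∑ l, S i l * x l = 0 :=
    le_antisymm (Finset.sum_nonpos fun l _ => term_nonpos l) hSx
  have h := (Finset.sum_eq_zero_iff_of_nonpos fun l _ => term_nonpos l).mp sum_zero j
    (Finset.mem_univ j)
  exact (mul_eq_zero.mp h).resolve_left hij.ne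

variable [DecidableEq ι]

lemma inv_nonneg_of_offDiag_nonpos (hS : S.PosDef) (hoff : ∀ i j, i ≠ j → S i j ≤ 0) (i j : ι) :
    0 ≤ S⁻¹ i j := by
  have hcol : S *ᵥ S⁻¹.col j = Pi.single j 1 := by
    rw [← Matrix.mulVec_single_one, Matrix.mulVec_mulVec,
      Matrix.mul_nonsing_inv _ hS.det_pos.ne'.isUnit, Matrix.one_mulVec]
  exact nonneg_of_mulVec_nonneg hS hoff (hcol ▸ Pi.single_nonneg.mpr zero_le_one) i

/-- Cramer's rule: the entries of `det A • A⁻¹` are integers. -/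
lemma one_le_det_mul_inv_of_pos {A : Matrix ι ι ℤ} (hdet : 0 < (A.map (Int.castRingHom ℝ)).det)
    {i j : ι} (hpos : 0 < (A.map (Int.castRingHom ℝ))⁻¹ i j) :
    1 ≤ (A.map (Int.castRingHom ℝ)).det * (A.map (Int.castRingHom ℝ))⁻¹ i j := by
  have adjugate_eq : (A.map (Int.castRingHom ℝ)).det * (A.map (Int.castRingHom ℝ))⁻¹ i j =
      (A.adjugate i j : ℝ) := by
    rw [Matrix.inv_def, Matrix.smul_apply, smul_eq_mul, Ring.inverse_eq_inv',
      mul_inv_cancel_left₀ hdet.ne']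
    exact (congrFun₂ ((Int.castRingHom ℝ).map_adjugate A) i j).symm
  have hmul := mul_pos hdet hpos
  rw [adjugate_eq] at hmul ⊢
  exact_mod_cast Int.cast_pos.mp hmul

end MMatrix

/-! ### The matrix `Ω = (I + L)⁻¹` -/

lemma energyNorm_nonneg {n : ℕ} (S : Matrix (Fin n) (Fin n) ℝ) (x : Fin n → ℝ) :
    0 ≤ energyNorm S x :=
  Real.sqrt_nonneg _

lemma sq_energyNorm {n : ℕ} {S : Matrix (Fin n) (Fin n) ℝ} (hS : S.PosSemidef) (x : Fin n → ℝ) :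
    energyNorm S x ^ 2 = x ⬝ᵥ (S *ᵥ x) :=
  Real.sq_sqrt (by simpa using hS.dotProduct_mulVec_nonneg x)

section ShiftedLap

variable {n m : ℕ} {G : SimpleGraph (Fin n)} [DecidableRel G.Adj]

lemma dotProduct_shiftedLap_mulVec_self (x : Fin n → ℝ) :
    x ⬝ᵥ (shiftedLap G *ᵥ x) =
      x ⬝ᵥ x + (∑ i, ∑ j, if G.Adj i j then (x i - x j) ^ 2 else 0) / 2 := by
  rw [shiftedLap, Matrix.add_mulVec, Matrix.one_mulVec, dotProduct_add,
    ← SimpleGraph.lapMatrix_toLinearMap₂', Matrix.toLinearMap₂'_apply']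

lemma dotProduct_self_le_energy (x : Fin n → ℝ) : x ⬝ᵥ x ≤ x ⬝ᵥ (shiftedLap G *ᵥ x) := by
  rw [dotProduct_shiftedLap_mulVec_self]
  have : 0 ≤ ∑ i, ∑ j, if G.Adj i j then (x i - x j) ^ 2 else 0 := by positivity
  linarith

lemma energy_le (x : Fin n → ℝ) : x ⬝ᵥ (shiftedLap G *ᵥ x) ≤ (n + 1) * (x ⬝ᵥ x) := by
  have le_complete : (∑ i, ∑ j, if G.Adj i j then (x i - x j) ^ 2 else 0) ≤
      ∑ i, ∑ j, (x i - x j) ^ 2 := by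
    gcongr with i _ j _
    split_ifs
    exacts [le_rfl, sq_nonneg _]
  have complete_eq : ∑ i, ∑ j, (x i - x j) ^ 2 = 2 * (n * (x ⬝ᵥ x)) - 2 * (∑ i, x i) ^ 2 := by
    simp only [sub_sq, Finset.sum_sub_distrib, Finset.sum_add_distrib, Finset.sum_const,
      Finset.card_univ, Fintype.card_fin, ← Finset.mul_sum, ← Finset.sum_mul, dotProduct,
      nsmul_eq_mul, mul_assoc, ← pow_two]
    ring
  rw [dotProduct_shiftedLap_mulVec_self]
  linarith [sq_nonneg (∑ i, x i)]

variable (G) in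
lemma posDef_shiftedLap : (shiftedLap G).PosDef :=
  Matrix.PosDef.one.add_posSemidef (G.posSemidef_lapMatrix ℝ)

lemma abs_apply_le_energyNorm (x : Fin n → ℝ) (i : Fin n) :
    |x i| ≤ energyNorm (shiftedLap G) x := by
  refine abs_le_of_sq_le_sq ?_ (energyNorm_nonneg _ _)
  rw [sq_energyNorm (posDef_shiftedLap G).posSemidef, pow_two]
  exact (Finset.single_le_sum (f := fun j => x j * x j) (fun j _ => mul_self_nonneg (x j))
    (Finset.mem_univ i)).trans (dotProduct_self_le_energy x)

variable (G) in
lemma shiftedLap_mulVec_one : shiftedLap G *ᵥ 1 = 1 := by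
  have h : G.lapMatrix ℝ *ᵥ 1 = 0 := SimpleGraph.lapMatrix_mulVec_const_eq_zero G
  rw [shiftedLap, Matrix.add_mulVec, Matrix.one_mulVec, h, add_zero]

lemma shiftedLap_apply_of_ne {i j : Fin n} (h : i ≠ j) :
    shiftedLap G i j = -if G.Adj i j then 1 else 0 := by
  simp [shiftedLap, SimpleGraph.lapMatrix, SimpleGraph.degMatrix, Matrix.diagonal_apply_ne _ h,
    SimpleGraph.adjMatrix_apply, Matrix.one_apply_ne h]

variable (G) in
lemma shiftedLap_nonpos_of_ne (i j : Fin n) (h : i ≠ j) : shiftedLap G i j ≤ 0 := by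
  rw [shiftedLap_apply_of_ne h]
  split_ifs <;> simp

variable (G) in
lemma isSDDM_shiftedLap : IsSDDM (shiftedLap G) where
  posDef := posDef_shiftedLap G
  offDiag := shiftedLap_nonpos_of_ne G
  rowSum i := by
    have sum_eq_one : ∑ j, shiftedLap G i j = 1 := by
      simpa [Matrix.mulVec, dotProduct] using congrFun (shiftedLap_mulVec_one G) i
    exact sum_eq_one ▸ zero_le_one

variable (G) in
lemma det_shiftedLap_pos : 0 < (shiftedLap G).det := (posDef_shiftedLap G).det_pos

variable (G) in
lemma isUnit_det_shiftedLap : IsUnit (shiftedLap G).det := (det_shiftedLap_pos G).ne'.isUnit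

lemma shiftedLap_mulVec_equilibrium (b : Fin n → ℝ) : shiftedLap G *ᵥ equilibrium G b = b := by
  rw [equilibrium, Matrix.mulVec_mulVec, Matrix.mul_nonsing_inv _ (isUnit_det_shiftedLap G),
    Matrix.one_mulVec]

variable (G) in
lemma isSymm_omega : (shiftedLap G)⁻¹.IsSymm :=
  Matrix.isHermitian_iff_isSymm.mp (posDef_shiftedLap G).inv.isHermitian

variable (G) in
lemma shiftedLap_mulVec_omega (i : Fin n) : shiftedLap G *ᵥ (shiftedLap G)⁻¹ i = Pi.single i 1 := by
  have hrow : (shiftedLap G)⁻¹ i = equilibrium G (Pi.single i 1) := by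
    rw [equilibrium, Matrix.mulVec_single_one]
    exact funext fun j => (isSymm_omega G).apply j i
  rw [hrow, shiftedLap_mulVec_equilibrium]

variable (G) in
lemma omega_nonneg (i j : Fin n) : 0 ≤ (shiftedLap G)⁻¹ i j :=
  inv_nonneg_of_offDiag_nonpos (posDef_shiftedLap G) (shiftedLap_nonpos_of_ne G) i j

lemma equilibrium_nonneg {b : Fin n → ℝ} (hb : 0 ≤ b) : 0 ≤ equilibrium G b := fun i =>
  dotProduct_nonneg_of_nonneg (omega_nonneg G i) hb

variable (G) in
lemma omega_mulVec_one : (shiftedLap G)⁻¹ *ᵥ 1 = 1 := by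
  conv_lhs => rw [← shiftedLap_mulVec_one G]
  rw [Matrix.mulVec_mulVec, Matrix.nonsing_inv_mul _ (isUnit_det_shiftedLap G), Matrix.one_mulVec]

variable (G) in
lemma omega_le_one (i j : Fin n) : (shiftedLap G)⁻¹ i j ≤ 1 := by
  have sum_eq_one : ∑ j, (shiftedLap G)⁻¹ i j = 1 := by
    simpa [Matrix.mulVec, dotProduct] using congrFun (omega_mulVec_one G) i
  exact sum_eq_one ▸ Finset.single_le_sum (fun j _ => omega_nonneg G i j) (Finset.mem_univ j)

lemma omega_pos (hG : G.Connected) (i j : Fin n) : 0 < (shiftedLap G)⁻¹ i j := by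
  have hS := shiftedLap_mulVec_omega G i
  have hnonneg : 0 ≤ shiftedLap G *ᵥ (shiftedLap G)⁻¹ i := hS ▸ Pi.single_nonneg.mpr zero_le_one
  have propagate {k l : Fin n} (hkl : G.Adj k l) (hk : (shiftedLap G)⁻¹ i k = 0) :
      (shiftedLap G)⁻¹ i l = 0 :=
    apply_eq_zero_of_mulVec_nonneg (shiftedLap_nonpos_of_ne G) (omega_nonneg G i) (hnonneg k) hk
      (by simp [shiftedLap_apply_of_ne hkl.ne, hkl])
  refine (omega_nonneg G i j).lt_of_ne' fun hj => ?_
  have row_eq_zero : (shiftedLap G)⁻¹ i = 0 := by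
    funext l
    obtain ⟨w⟩ := hG.preconnected j l
    induction w with
    | nil => exact hj
    | cons h _ ih => exact ih (propagate h hj)
  rw [row_eq_zero, Matrix.mulVec_zero] at hS
  simpa using congrFun hS i

lemma one_le_det_mul_omega (hG : G.Connected) (i j : Fin n) :
    1 ≤ (shiftedLap G).det * (shiftedLap G)⁻¹ i j := by
  have hint : shiftedLap G = (1 + G.lapMatrix ℤ).map (Int.castRingHom ℝ) := by
    ext a b
    by_cases hab : a = b
    · subst hab
      simp [shiftedLap, SimpleGraph.lapMatrix, SimpleGraph.degMatrix]
    · simp [shiftedLap, SimpleGraph.lapMatrix, SimpleGraph.degMatrix, hab,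
        SimpleGraph.adjMatrix_apply]
  have hdet := det_shiftedLap_pos G
  have hpos := omega_pos hG i j
  rw [hint] at hdet hpos ⊢
  exact one_le_det_mul_inv_of_pos hdet hpos

lemma shiftedLap_apply_self_le (i : Fin n) : shiftedLap G i i ≤ n + 1 := by
  simpa using energy_le (G := G) (Pi.single i 1)

variable (G) in
lemma one_div_le_omega_self (i : Fin n) : 1 / ((n : ℝ) + 1) ≤ (shiftedLap G)⁻¹ i i := by
  have hrow : ∑ j, shiftedLap G i j * (shiftedLap G)⁻¹ i j = 1 :=
    (congrFun (shiftedLap_mulVec_omega G i) i).trans (Pi.single_eq_same i 1)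
  rw [← Finset.add_sum_erase _ _ (Finset.mem_univ i)] at hrow
  have offDiag_nonpos : ∑ j ∈ Finset.univ.erase i, shiftedLap G i j * (shiftedLap G)⁻¹ i j ≤ 0 :=
    Finset.sum_nonpos fun j hj => mul_nonpos_of_nonpos_of_nonneg
      (shiftedLap_nonpos_of_ne G i j (Finset.ne_of_mem_erase hj).symm) (omega_nonneg G i j)
  have diag_le := mul_le_mul_of_nonneg_right (shiftedLap_apply_self_le (G := G) i)
    (omega_nonneg G i i)
  rw [div_le_iff₀ (by positivity)]
  linarith

lemma omega_self_eq (edges : EdgeList G m) (i : Fin n) :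
    (shiftedLap G)⁻¹ i i =
      (incidence edges *ᵥ (shiftedLap G)⁻¹ i) ⬝ᵥ (incidence edges *ᵥ (shiftedLap G)⁻¹ i) +
        (shiftedLap G)⁻¹ i ⬝ᵥ (shiftedLap G)⁻¹ i := by
  set x := (shiftedLap G)⁻¹ i
  have energy_eq : x ⬝ᵥ (shiftedLap G *ᵥ x) = x i := by
    rw [shiftedLap_mulVec_omega, dotProduct_single, mul_one]
  rw [← energy_eq, shiftedLap, Matrix.add_mulVec, Matrix.one_mulVec, dotProduct_add, add_comm,
    ← transpose_incidence_mul_incidence edges, ← Matrix.mulVec_mulVec, Matrix.dotProduct_mulVec,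
    Matrix.vecMul_transpose]

lemma nnz_shiftedLap_le (edges : EdgeList G m) : nnz (shiftedLap G) ≤ n + 2 * m := by
  have hsub : {x : Fin n × Fin n | shiftedLap G x.1 x.2 ≠ 0} ⊆
      Set.range (Sum.elim (fun i : Fin n => (i, i)) (Sum.elim
        (fun e : Fin m => (edges.head e, edges.tail e))
        fun e : Fin m => (edges.tail e, edges.head e))) := by
    rintro ⟨i, j⟩ hne
    rcases eq_or_ne i j with rfl | hij
    · exact ⟨Sum.inl i, rfl⟩
    · have hadj : G.Adj i j := by
        by_contra hnot
        exact hne (by simp [shiftedLap_apply_of_ne hij, hnot])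
      obtain ⟨e, he⟩ := edges.surj i j hadj
      rcases Sym2.eq_iff.mp he with ⟨rfl, rfl⟩ | ⟨rfl, rfl⟩
      · exact ⟨Sum.inr (Sum.inl e), rfl⟩
      · exact ⟨Sum.inr (Sum.inr e), rfl⟩
  calc nnz (shiftedLap G) ≤ _ := Set.ncard_le_ncard hsub (Set.finite_range _)
    _ ≤ (Set.univ : Set (Fin n ⊕ Fin m ⊕ Fin m)).ncard := by
      rw [← Set.image_univ]
      exact Set.ncard_image_le Set.finite_univ
    _ = n + 2 * m := by simp [two_mul]

end ShiftedLap

lemma EdgeList.card_le_add_one {n m : ℕ} {G : SimpleGraph (Fin n)} (edges : EdgeList G m)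
    (hG : G.Connected) : n ≤ m + 1 := by
  have hsurj : Function.Surjective
      fun e : Fin m => (⟨s(edges.head e, edges.tail e), edges.adj e⟩ : G.edgeSet) := by
    rintro ⟨x, hx⟩
    induction x using Sym2.ind with
    | _ i j =>
      obtain ⟨e, he⟩ := edges.surj i j hx
      exact ⟨e, Subtype.ext he⟩
  calc n = Nat.card (Fin n) := by simp
    _ ≤ Nat.card G.edgeSet + 1 := hG.card_vert_le_card_edgeSet_add_one
    _ ≤ m + 1 := by simpa using Nat.card_le_card_of_surjective _ hsurj

/-! ### Concentration of random projections -/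

section SubgaussianSquare

variable {Ω : Type*} [MeasurableSpace Ω] {μ : Measure Ω} {Z : Ω → ℝ}

lemma lintegral_exp_sq_gaussianReal {t : ℝ} (ht : 2 * t < 1) :
    ∫⁻ g, ENNReal.ofReal (Real.exp (t * g ^ 2)) ∂gaussianReal 0 1 =
      ENNReal.ofReal √(1 / (1 - 2 * t)) := by
  have hb : 0 < 1 / 2 - t := by linarith
  have density_mul_exp (g : ℝ) : gaussianPDFReal 0 1 g * Real.exp (t * g ^ 2) =
      (√(2 * Real.pi))⁻¹ * Real.exp (-(1 / 2 - t) * g ^ 2) := by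
    simp only [gaussianPDFReal_def, NNReal.coe_one, mul_one, sub_zero]
    rw [mul_assoc, ← Real.exp_add]
    congr 2
    ring
  have integrand_eq (g : ℝ) :
      (gaussianPDF 0 1 * fun g => ENNReal.ofReal (Real.exp (t * g ^ 2))) g =
        ENNReal.ofReal ((√(2 * Real.pi))⁻¹ * Real.exp (-(1 / 2 - t) * g ^ 2)) := by
    rw [← density_mul_exp, Pi.mul_apply, gaussianPDF,
      ENNReal.ofReal_mul (gaussianPDFReal_nonneg 0 1 g)]
  rw [gaussianReal_of_var_ne_zero 0 one_ne_zero,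
    lintegral_withDensity_eq_lintegral_mul _ (measurable_gaussianPDF 0 1) (by fun_prop),
    lintegral_congr integrand_eq, ← ofReal_integral_eq_lintegral_ofReal
      ((integrable_exp_neg_mul_sq hb).const_mul _) (ae_of_all _ fun g => by positivity),
    integral_const_mul, integral_gaussian, ← Real.sqrt_inv, ← Real.sqrt_mul (by positivity)]
  congr 2
  have : (1 : ℝ) - 2 * t ≠ 0 := by linarith
  have : (1 : ℝ) / 2 - t ≠ 0 := hb.ne'
  have := Real.pi_pos.ne'
  field_simp

lemma lintegral_exp_mul_gaussianReal (t : ℝ) :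
    ∫⁻ g, ENNReal.ofReal (Real.exp (t * g)) ∂gaussianReal 0 1 =
      ENNReal.ofReal (Real.exp (t ^ 2 / 2)) := by
  have hmgf : ∫ g, Real.exp (t * g) ∂gaussianReal 0 1 = Real.exp (t ^ 2 / 2) := by
    simpa [mgf] using congrFun (mgf_id_gaussianReal (μ := 0) (v := 1)) t
  rw [← hmgf, ofReal_integral_eq_lintegral_ofReal (integrable_exp_mul_gaussianReal t)
    (ae_of_all _ fun g => (Real.exp_pos _).le)]

lemma one_add_sq_add_pow_four_le_cosh (u : ℝ) : 1 + u ^ 2 / 2 + u ^ 4 / 24 ≤ Real.cosh u := by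
  have h := sum_le_hasSum (Finset.range 3)
    (fun n _ => div_nonneg (Even.pow_nonneg (even_two_mul n) u) (Nat.cast_nonneg _))
    (Real.hasSum_cosh u)
  simp only [Finset.sum_range_succ, Finset.sum_range_zero, Nat.factorial] at h
  norm_num at h
  linarith

lemma integrable_cosh_mul {c : ℝ≥0} (hZ : HasSubgaussianMGF Z c μ) (t : ℝ) :
    Integrable (fun ω => Real.cosh (t * Z ω)) μ := by
  simp only [Real.cosh_eq, ← neg_mul]
  exact ((hZ.integrable_exp_mul t).add (hZ.integrable_exp_mul (-t))).div_const 2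

lemma integral_cosh_mul_le {c : ℝ≥0} (hZ : HasSubgaussianMGF Z c μ) (t : ℝ) :
    ∫ ω, Real.cosh (t * Z ω) ∂μ ≤ Real.exp (c * t ^ 2 / 2) := by
  have hpos := hZ.mgf_le t
  have hneg := hZ.mgf_le (-t)
  rw [neg_sq] at hneg
  simp only [Real.cosh_eq, ← neg_mul]
  rw [integral_div, integral_add (hZ.integrable_exp_mul t) (hZ.integrable_exp_mul (-t))]
  rw [mgf] at hpos hneg
  linarith

lemma integrable_pow_of_hasSubgaussianMGF {c : ℝ≥0} (hZ : HasSubgaussianMGF Z c μ) (k : ℕ) :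
    Integrable (fun ω => Z ω ^ k) μ :=
  integrable_pow_of_integrable_exp_mul one_ne_zero (hZ.integrable_exp_mul 1)
    (hZ.integrable_exp_mul (-1)) k

variable [IsProbabilityMeasure μ]

-- Gaussian linearization: `exp (t Z ^ 2)` is the average of `exp (√(2 t) Z g)` over a standard
-- Gaussian `g`, so the sub-Gaussian bound on the Laplace transform of `Z` applies for each `g`.
lemma lintegral_exp_sq_le (hZm : Measurable Z) (hZ : HasSubgaussianMGF Z 1 μ) {t : ℝ}
    (ht0 : 0 ≤ t) (ht : 2 * t < 1) :
    ∫⁻ ω, ENNReal.ofReal (Real.exp (t * Z ω ^ 2)) ∂μ ≤ ENNReal.ofReal √(1 / (1 - 2 * t)) := by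
  rw [← lintegral_exp_sq_gaussianReal ht]
  have hsq : √(2 * t) ^ 2 = 2 * t := Real.sq_sqrt (by linarith)
  calc ∫⁻ ω, ENNReal.ofReal (Real.exp (t * Z ω ^ 2)) ∂μ
      = ∫⁻ ω, ∫⁻ g, ENNReal.ofReal (Real.exp (√(2 * t) * Z ω * g)) ∂gaussianReal 0 1 ∂μ := by
        refine lintegral_congr fun ω => ?_
        rw [lintegral_exp_mul_gaussianReal, mul_pow, hsq]
        congr 2
        ring
    _ = ∫⁻ g, ∫⁻ ω, ENNReal.ofReal (Real.exp (√(2 * t) * g * Z ω)) ∂μ ∂gaussianReal 0 1 := by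
        simp only [mul_right_comm _ (Z _)]
        exact lintegral_lintegral_swap (by fun_prop)
    _ ≤ ∫⁻ g, ENNReal.ofReal (Real.exp (t * g ^ 2)) ∂gaussianReal 0 1 := by
        refine lintegral_mono fun g => ?_
        rw [← ofReal_integral_eq_lintegral_ofReal (hZ.integrable_exp_mul _)
          (ae_of_all _ fun ω => (Real.exp_pos _).le)]
        refine ENNReal.ofReal_le_ofReal ((hZ.mgf_le _).trans_eq ?_)
        rw [mul_pow, hsq, NNReal.coe_one]
        congr 1
        ring

lemma integral_quartic (hZ : HasSubgaussianMGF Z 1 μ) (hvar : ∫ ω, Z ω ^ 2 ∂μ = 1) (a b c : ℝ) :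
    Integrable (fun ω => a + b * Z ω ^ 2 + c * Z ω ^ 4) μ ∧
      ∫ ω, (a + b * Z ω ^ 2 + c * Z ω ^ 4) ∂μ = a + b + c * ∫ ω, Z ω ^ 4 ∂μ := by
  have hsq := (integrable_pow_of_hasSubgaussianMGF hZ 2).const_mul b
  have hfour := (integrable_pow_of_hasSubgaussianMGF hZ 4).const_mul c
  have hlow : Integrable (fun ω => a + b * Z ω ^ 2) μ := (integrable_const a).add hsq
  refine ⟨hlow.add hfour, ?_⟩
  rw [integral_add hlow hfour, integral_add (integrable_const a) hsq, integral_const_mul,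
    integral_const_mul, hvar, integral_const, probReal_univ, one_smul, mul_one]

-- Compare `E cosh (Z / 4) ≤ exp (1 / 32)` with the Taylor polynomial of degree four of `cosh`.
lemma integral_pow_four_le (hZ : HasSubgaussianMGF Z 1 μ) (hvar : ∫ ω, Z ω ^ 2 ∂μ = 1) :
    ∫ ω, Z ω ^ 4 ∂μ ≤ 31 / 10 := by
  obtain ⟨hint, heq⟩ := integral_quartic hZ hvar 1 (1 / 32) (1 / 6144)
  have taylor_le : ∫ ω, (1 + 1 / 32 * Z ω ^ 2 + 1 / 6144 * Z ω ^ 4) ∂μ ≤ Real.exp (1 / 32) := by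
    refine (integral_mono hint (integrable_cosh_mul hZ (1 / 4)) fun ω => ?_).trans
      ((integral_cosh_mul_le hZ (1 / 4)).trans_eq (by norm_num))
    have := one_add_sq_add_pow_four_le_cosh (1 / 4 * Z ω)
    ring_nf at this ⊢
    linarith
  have exp_le : Real.exp (1 / 32) ≤ 1 + 1 / 32 + 1 / 2048 + 1 / 100000 := by
    have := Real.exp_bound' (x := 1 / 32) (by norm_num) (by norm_num) (n := 3) (by norm_num)
    norm_num [Finset.sum_range_succ, Nat.factorial] at this ⊢
    linarith
  linarith

lemma exp_neg_le_one_sub_add_sq {x : ℝ} (hx : 0 ≤ x) : Real.exp (-x) ≤ 1 - x + x ^ 2 / 2 := by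
  have hpos : 0 < 1 - x + x ^ 2 / 2 := by nlinarith [sq_nonneg (x - 1)]
  rw [Real.exp_neg, inv_le_comm₀ (Real.exp_pos _) hpos]
  refine le_trans ?_ (Real.quadratic_le_exp_of_nonneg hx)
  rw [inv_le_iff_one_le_mul₀ hpos]
  nlinarith [sq_nonneg (x ^ 2)]

lemma lintegral_exp_neg_sq_le (hZ : HasSubgaussianMGF Z 1 μ) (hvar : ∫ ω, Z ω ^ 2 ∂μ = 1)
    {t : ℝ} (ht : 0 ≤ t) :
    ∫⁻ ω, ENNReal.ofReal (Real.exp (-t * Z ω ^ 2)) ∂μ ≤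
      ENNReal.ofReal (1 - t + 31 / 20 * t ^ 2) := by
  obtain ⟨hint, heq⟩ := integral_quartic hZ hvar 1 (-t) (t ^ 2 / 2)
  have exp_le (ω : Ω) : Real.exp (-t * Z ω ^ 2) ≤ 1 + -t * Z ω ^ 2 + t ^ 2 / 2 * Z ω ^ 4 := by
    rw [neg_mul]
    exact (exp_neg_le_one_sub_add_sq (by positivity)).trans_eq (by ring)
  calc ∫⁻ ω, ENNReal.ofReal (Real.exp (-t * Z ω ^ 2)) ∂μ
      ≤ ∫⁻ ω, ENNReal.ofReal (1 + -t * Z ω ^ 2 + t ^ 2 / 2 * Z ω ^ 4) ∂μ :=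
        lintegral_mono fun ω => ENNReal.ofReal_le_ofReal (exp_le ω)
    _ = ENNReal.ofReal (∫ ω, (1 + -t * Z ω ^ 2 + t ^ 2 / 2 * Z ω ^ 4) ∂μ) :=
        (ofReal_integral_eq_lintegral_ofReal hint
          (ae_of_all _ fun ω => (Real.exp_pos _).le.trans (exp_le ω))).symm
    _ ≤ ENNReal.ofReal (1 - t + 31 / 20 * t ^ 2) := by
        refine ENNReal.ofReal_le_ofReal ?_
        rw [heq]
        nlinarith [integral_pow_four_le hZ hvar, sq_nonneg t]

lemma measure_pi_sum_ge_le {ι : Type*} [Fintype ι] {F : Ω → ℝ} (hF : Measurable F) {c : ℝ}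
    (h : ∫⁻ ω, ENNReal.ofReal (Real.exp (F ω)) ∂μ ≤ ENNReal.ofReal (Real.exp c)) (a : ℝ) :
    (Measure.pi fun _ : ι => μ) {x | a ≤ ∑ r, F (x r)} ≤
      ENNReal.ofReal (Real.exp (Fintype.card ι * c - a)) := by
  have hexp : Measurable fun ω => ENNReal.ofReal (Real.exp (F ω)) := by fun_prop
  have lintegral_prod :
      ∫⁻ x, ∏ r, ENNReal.ofReal (Real.exp (F (x r))) ∂Measure.pi (fun _ : ι => μ) =
        (∫⁻ ω, ENNReal.ofReal (Real.exp (F ω)) ∂μ) ^ Fintype.card ι := by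
    rw [lintegral_prod_eq_prod_lintegral_of_indepFun Finset.univ _
      (iIndepFun_pi (μ := fun _ : ι => μ) fun _ => hexp.aemeasurable) fun r => by fun_prop]
    simp only [fun r => (measurePreserving_eval (fun _ : ι => μ) r).lintegral_comp hexp,
      Finset.prod_const, Finset.card_univ]
  have hset : {x : ι → Ω | a ≤ ∑ r, F (x r)} =
      {x | ENNReal.ofReal (Real.exp a) ≤ ∏ r, ENNReal.ofReal (Real.exp (F (x r)))} := by
    ext x
    simp only [Set.mem_ofPred_eq]
    rw [← ENNReal.ofReal_prod_of_nonneg fun _ _ => (Real.exp_pos _).le, ← Real.exp_sum,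
      ENNReal.ofReal_le_ofReal_iff (Real.exp_pos _).le, Real.exp_le_exp]
  have hmeas : Measurable fun x : ι → Ω => ∏ r, ENNReal.ofReal (Real.exp (F (x r))) := by fun_prop
  rw [hset]
  refine (meas_ge_le_lintegral_div hmeas.aemeasurable (by simp [Real.exp_pos]) (by simp)).trans ?_
  rw [lintegral_prod, Real.exp_sub, ENNReal.ofReal_div_of_pos (Real.exp_pos _), Real.exp_nat_mul,
    ENNReal.ofReal_pow (Real.exp_pos _).le]
  gcongr

lemma sqrt_one_div_one_sub_le {x : ℝ} (h0 : 0 ≤ x) (h1 : x ≤ 1 / 24) :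
    √(1 / (1 - x)) ≤ Real.exp (x / 2 + x ^ 2 / 4 + x ^ 3 / 2) := by
  refine Real.sqrt_le_iff.mpr ⟨(Real.exp_pos _).le, ?_⟩
  rw [← Real.exp_nat_mul, div_le_iff₀ (by linarith)]
  set y := x + x ^ 2 / 2 + x ^ 3
  have exponent_eq : ((2 : ℕ) : ℝ) * (x / 2 + x ^ 2 / 4 + x ^ 3 / 2) = y := by
    push_cast
    ring
  have poly_nonneg : 0 ≤ 1 / 2 - 3 / 8 * x - 5 / 8 * x ^ 2 - x ^ 4 / 2 := by
    have : x ^ 2 ≤ 1 := by nlinarith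
    have : x ^ 4 ≤ x ^ 2 := by nlinarith [sq_nonneg x]
    nlinarith
  calc (1 : ℝ) ≤ 1 + x ^ 3 * (1 / 2 - 3 / 8 * x - 5 / 8 * x ^ 2 - x ^ 4 / 2) :=
        le_add_of_nonneg_right (mul_nonneg (pow_nonneg h0 3) poly_nonneg)
    _ = (1 + y + y ^ 2 / 2) * (1 - x) := by ring
    _ ≤ Real.exp (((2 : ℕ) : ℝ) * (x / 2 + x ^ 2 / 4 + x ^ 3 / 2)) * (1 - x) := by
        rw [exponent_eq]
        exact mul_le_mul_of_nonneg_right (Real.quadratic_le_exp_of_nonneg (by positivity))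
          (by linarith)

lemma one_sub_add_sq_le_exp {t : ℝ} (h0 : 0 ≤ t) (h1 : t ≤ 1 / 48) :
    1 - t + 31 / 20 * t ^ 2 ≤ Real.exp (-t + 11 / 10 * t ^ 2) := by
  set u := -t + 11 / 10 * t ^ 2 with hu
  have abs_u_le : |u| ≤ t := by rw [abs_le]; constructor <;> nlinarith
  have hexp := Real.exp_bound (x := u) (n := 3) (by linarith) (by norm_num)
  norm_num [Finset.sum_range_succ, Nat.factorial] at hexp
  have hcube : |u| ^ 3 ≤ t ^ 3 := pow_le_pow_left₀ (abs_nonneg _) abs_u_le 3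
  have : t ^ 3 ≤ t ^ 2 / 48 := by nlinarith [sq_nonneg t]
  nlinarith [(abs_le.mp hexp).1, sq_nonneg t, sq_nonneg (t ^ 2)]

lemma measure_pi_abs_sum_sq_sub_le {ι : Type*} [Fintype ι] (hZm : Measurable Z)
    (hZ : HasSubgaussianMGF Z 1 μ) (hvar : ∫ ω, Z ω ^ 2 ∂μ = 1) {β : ℝ} (hβ0 : 0 < β)
    (hβ : β ≤ 1 / 24) :
    (Measure.pi fun _ : ι => μ)
        {x | ¬ |∑ r, Z (x r) ^ 2 - Fintype.card ι| ≤ β * Fintype.card ι} ≤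
      2 * ENNReal.ofReal (Real.exp (-(5 / 24) * β ^ 2 * Fintype.card ι)) := by
  have hp := Nat.cast_nonneg (α := ℝ) (Fintype.card ι)
  set p : ℝ := (Fintype.card ι : ℝ)
  have upper : (Measure.pi fun _ : ι => μ)
      {x | β / 2 * (1 + β) * p ≤ ∑ r, β / 2 * Z (x r) ^ 2} ≤
      ENNReal.ofReal (Real.exp (-(5 / 24) * β ^ 2 * p)) := by
    have hm := lintegral_exp_sq_le hZm hZ (t := β / 2) (by linarith) (by linarith)
    rw [mul_div_cancel₀ β two_ne_zero] at hm
    replace hm := hm.trans (ENNReal.ofReal_le_ofReal (sqrt_one_div_one_sub_le hβ0.le hβ))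
    refine (measure_pi_sum_ge_le (F := fun ω => β / 2 * Z ω ^ 2) (by fun_prop) hm _).trans
      (ENNReal.ofReal_le_ofReal (Real.exp_le_exp.mpr ?_))
    have : β ^ 3 ≤ β ^ 2 / 24 := by nlinarith [sq_nonneg β]
    nlinarith [sq_nonneg β]
  have lower : (Measure.pi fun _ : ι => μ)
      {x | -(β / 2) * (1 - β) * p ≤ ∑ r, -(β / 2) * Z (x r) ^ 2} ≤
      ENNReal.ofReal (Real.exp (-(5 / 24) * β ^ 2 * p)) := by
    have hm := (lintegral_exp_neg_sq_le hZ hvar (t := β / 2) (by linarith)).trans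
      (ENNReal.ofReal_le_ofReal (one_sub_add_sq_le_exp (t := β / 2) (by linarith) (by linarith)))
    refine (measure_pi_sum_ge_le (by fun_prop) hm _).trans
      (ENNReal.ofReal_le_ofReal (Real.exp_le_exp.mpr ?_))
    nlinarith [sq_nonneg β, mul_nonneg hp (sq_nonneg β)]
  have hsub : {x : ι → Ω | ¬ |∑ r, Z (x r) ^ 2 - p| ≤ β * p} ⊆
      {x | β / 2 * (1 + β) * p ≤ ∑ r, β / 2 * Z (x r) ^ 2} ∪
      {x | -(β / 2) * (1 - β) * p ≤ ∑ r, -(β / 2) * Z (x r) ^ 2} := by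
    intro x hx
    simp only [Set.mem_ofPred_eq, not_le, lt_abs] at hx
    simp only [Set.mem_union, Set.mem_ofPred_eq, ← Finset.mul_sum]
    rcases hx with hx | hx
    · left; nlinarith
    · right; nlinarith
  rw [two_mul]
  exact (measure_mono hsub).trans ((measure_union_le _ _).trans (add_le_add upper lower))

end SubgaussianSquare

section RandomProjection

variable {ι : Type*} [Fintype ι] {ν : Measure ℝ} [IsProbabilityMeasure ν]

lemma hasSubgaussianMGF_dotProduct {c : ℝ≥0} (hν : HasSubgaussianMGF id c ν) (w : ι → ℝ) :
    HasSubgaussianMGF (fun x => x ⬝ᵥ w) ((w ⬝ᵥ w).toNNReal * c) (Measure.pi fun _ => ν) := by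
  have coord (i : ι) : HasSubgaussianMGF (fun x : ι → ℝ => w i * x i)
      (⟨w i ^ 2, sq_nonneg _⟩ * c) (Measure.pi fun _ => ν) := by
    refine HasSubgaussianMGF.const_mul (X := fun x : ι → ℝ => x i) ?_ (w i)
    refine HasSubgaussianMGF.of_map (X := id) (measurable_pi_apply i).aemeasurable ?_
    rwa [(measurePreserving_eval (fun _ : ι => ν) i).map_eq]
  have hsum := HasSubgaussianMGF.sum_of_iIndepFun
    (iIndepFun_pi (μ := fun _ => ν) (X := fun i y => w i * y) fun i => by fun_prop)
    (s := Finset.univ) fun i _ => coord i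
  convert hsum using 1
  · funext x
    exact dotProduct_comm _ _
  · refine NNReal.eq ?_
    push_cast
    rw [Real.coe_toNNReal _ (show 0 ≤ w ⬝ᵥ w from dotProduct_self_star_nonneg w), dotProduct,
      Finset.sum_mul]
    exact Finset.sum_congr rfl fun i _ => by rw [← pow_two]; rfl

lemma integral_sq_dotProduct (hν : MemLp id 2 ν) (hmean : ∫ x, x ∂ν = 0) (w : ι → ℝ) :
    ∫ x, (x ⬝ᵥ w) ^ 2 ∂Measure.pi (fun _ => ν) = (w ⬝ᵥ w) * Var[id; ν] := by
  have hmem (i : ι) : MemLp (fun y : ℝ => w i * y) 2 ν := hν.const_mul (w i)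
  have projection_eq : (∑ i, fun x : ι → ℝ => w i * x i) = fun x => x ⬝ᵥ w := by
    funext x
    simp [dotProduct, mul_comm]
  have mean_eq_zero : ∫ x, x ⬝ᵥ w ∂Measure.pi (fun _ => ν) = 0 := by
    simp only [dotProduct]
    rw [integral_finsetSum]
    · refine Finset.sum_eq_zero fun i _ => ?_
      rw [integral_mul_const, integral_comp_eval (μ := fun _ : ι => ν) (f := fun y : ℝ => y)
        (by fun_prop), hmean, zero_mul]
    · exact fun i _ => ((measurePreserving_eval (fun _ : ι => ν) i).integrable_comp_of_integrable
        (hν.integrable one_le_two)).mul_const _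
  have hvar := variance_sum_pi (μ := fun _ : ι => ν) hmem
  rw [projection_eq, variance_of_integral_eq_zero (by fun_prop) mean_eq_zero] at hvar
  rw [hvar, dotProduct, Finset.sum_mul]
  exact Finset.sum_congr rfl fun i _ => by rw [← pow_two]; exact variance_const_mul (w i) id ν

theorem johnson_lindenstrauss {p : ℕ} (hp : 0 < p) (hν : HasSubgaussianMGF id (p : ℝ≥0)⁻¹ ν)
    (hmean : ∫ x, x ∂ν = 0) (hvar : Var[id; ν] = (p : ℝ)⁻¹) (v : ι → ℝ) {β : ℝ} (hβ0 : 0 < β)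
    (hβ : β ≤ 1 / 24) :
    (Measure.pi fun _ : Fin p => Measure.pi fun _ : ι => ν)
        {P | ¬ |∑ r, (P r ⬝ᵥ v) ^ 2 - v ⬝ᵥ v| ≤ β * (v ⬝ᵥ v)} ≤
      2 * ENNReal.ofReal (Real.exp (-(5 / 24) * β ^ 2 * p)) := by
  rcases eq_or_ne v 0 with rfl | hv
  · simp
  have hp' : (0 : ℝ) < p := Nat.cast_pos.mpr hp
  have hV : 0 < v ⬝ᵥ v := Matrix.dotProduct_self_star_pos_iff.mpr hv
  set V := v ⬝ᵥ v
  set w := √(p / V) • v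
  have hscale : √(p / V) ^ 2 = p / V := Real.sq_sqrt (by positivity)
  have norm_sq_w : w ⬝ᵥ w = p := by
    rw [smul_dotProduct, dotProduct_smul, smul_smul, ← pow_two, hscale, smul_eq_mul,
      div_mul_cancel₀ _ hV.ne']
  have hsub : HasSubgaussianMGF (fun x => x ⬝ᵥ w) 1 (Measure.pi fun _ : ι => ν) := by
    have h := hasSubgaussianMGF_dotProduct hν w
    rwa [norm_sq_w, Real.toNNReal_natCast, mul_inv_cancel₀ (by exact_mod_cast hp.ne')] at h
  have hsq : ∫ x, (x ⬝ᵥ w) ^ 2 ∂Measure.pi (fun _ : ι => ν) = 1 := by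
    rw [integral_sq_dotProduct (hν.memLp 2) hmean, norm_sq_w, hvar, mul_inv_cancel₀ hp'.ne']
  have tail := measure_pi_abs_sum_sq_sub_le (ι := Fin p) (by fun_prop) hsub hsq hβ0 hβ
  rw [Fintype.card_fin] at tail
  refine (measure_mono (Set.ofPred_subset_ofPred.mpr fun P => mt fun hclose => ?_)).trans tail
  have scaled : |p / V * (∑ r, (P r ⬝ᵥ v) ^ 2 - V)| ≤ p / V * (β * V) := by
    have lhs_eq : p / V * (∑ r, (P r ⬝ᵥ v) ^ 2 - V) = ∑ r, (P r ⬝ᵥ w) ^ 2 - p := by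
      simp only [w, dotProduct_smul, smul_eq_mul, mul_pow, hscale, ← Finset.mul_sum]
      field_simp
    have rhs_eq : p / V * (β * V) = β * p := by field_simp
    rwa [lhs_eq, rhs_eq]
  rw [abs_mul, abs_of_pos (by positivity : (0 : ℝ) < p / V)] at scaled
  exact le_of_mul_le_mul_left scaled (by positivity)

end RandomProjection

section EntryLaw

variable (κ : Sketch) {p : ℕ}

instance instIsProbabilityMeasureEntryLaw (p : ℕ) : IsProbabilityMeasure (κ.entryLaw p) := by
  cases κ with
  | sign => exact ⟨by simp [Sketch.entryLaw, ENNReal.inv_two_add_inv_two]⟩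
  | gaussian => exact inferInstanceAs (IsProbabilityMeasure (gaussianReal 0 _))

lemma integrable_sign_entryLaw (f : ℝ → ℝ) : Integrable f (Sketch.sign.entryLaw p) :=
  ((integrable_dirac (by simp)).smul_measure (by simp)).add_measure
    ((integrable_dirac (by simp)).smul_measure (by simp))

lemma integral_sign_entryLaw (f : ℝ → ℝ) :
    ∫ x, f x ∂Sketch.sign.entryLaw p = (f (1 / √p) + f (-(1 / √p))) / 2 := by
  rw [Sketch.entryLaw, integral_add_measure ((integrable_dirac (by simp)).smul_measure (by simp))
    ((integrable_dirac (by simp)).smul_measure (by simp)), integral_smul_measure,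
    integral_smul_measure, integral_dirac, integral_dirac]
  simp only [ENNReal.toReal_inv, ENNReal.toReal_ofNat, smul_eq_mul]
  ring

lemma integral_entryLaw : ∫ x, x ∂κ.entryLaw p = 0 := by
  cases κ with
  | sign => rw [integral_sign_entryLaw, add_neg_cancel, zero_div]
  | gaussian => exact integral_id_gaussianReal

lemma hasSubgaussianMGF_entryLaw : HasSubgaussianMGF id (p : ℝ≥0)⁻¹ (κ.entryLaw p) := by
  cases κ with
  | sign =>
    refine ⟨fun t => integrable_sign_entryLaw _, fun t => ?_⟩
    simp only [mgf, id]
    rw [integral_sign_entryLaw, mul_neg, ← Real.cosh_eq]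
    refine (Real.cosh_le_exp_half_sq _).trans_eq ?_
    rw [mul_pow, div_pow, Real.sq_sqrt (Nat.cast_nonneg p)]
    push_cast
    ring_nf
  | gaussian =>
    refine ⟨fun t => integrable_exp_mul_gaussianReal t, fun t => ?_⟩
    simp [Sketch.entryLaw, mgf_id_gaussianReal]

lemma variance_entryLaw : Var[id; κ.entryLaw p] = (p : ℝ)⁻¹ := by
  cases κ with
  | sign =>
    rw [variance_of_integral_eq_zero aemeasurable_id (integral_entryLaw _)]
    simp only [id]
    rw [integral_sign_entryLaw fun x => x ^ 2]
    simp
  | gaussian => simp [Sketch.entryLaw, variance_id_gaussianReal]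

end EntryLaw

/-! ### Sequential experiments on product spaces -/

section Product

variable {Ω Ω' : Type*} [MeasurableSpace Ω] [MeasurableSpace Ω']

-- `S` need not be measurable: Fubini is applied to its measurable hull.
lemma mul_le_measure_prod {μ : Measure Ω} {ν : Measure Ω'} [SFinite ν] {A : Set Ω}
    (hA : MeasurableSet A) {c : ℝ≥0∞} {S : Set (Ω × Ω')}
    (h : ∀ x ∈ A, c ≤ ν {y | (x, y) ∈ S}) : μ A * c ≤ (μ.prod ν) S := by
  rw [← measure_toMeasurable S, Measure.prod_apply (measurableSet_toMeasurable _ _), mul_comm,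
    ← lintegral_indicator_const hA]
  refine lintegral_mono fun x => ?_
  by_cases hx : x ∈ A
  · rw [Set.indicator_of_mem hx]
    exact (h x hx).trans (measure_mono fun y hy => subset_toMeasurable _ _ hy)
  · rw [Set.indicator_of_notMem hx]
    exact zero_le

variable {μ : Measure Ω} [IsProbabilityMeasure μ]

variable (μ) in
lemma measurePreserving_cons (k : ℕ) :
    MeasurePreserving (fun z : Ω × (Fin k → Ω) => (Fin.cons z.1 z.2 : Fin (k + 1) → Ω))
      (μ.prod (Measure.pi fun _ : Fin k => μ)) (Measure.pi fun _ : Fin (k + 1) => μ) := by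
  convert! (measurePreserving_piFinSuccAbove (fun _ : Fin (k + 1) => μ) 0).symm using 1
  funext z
  simp [MeasurableEquiv.piFinSuccAbove, Fin.insertNthEquiv]

lemma mul_le_measure_pi_succ {k : ℕ} {A : Set Ω} (hA : MeasurableSet A) {c : ℝ≥0∞}
    {S : Set (Fin (k + 1) → Ω)}
    (h : ∀ x ∈ A, c ≤ (Measure.pi fun _ : Fin k => μ) {y | (Fin.cons x y : Fin (k + 1) → Ω) ∈ S}) :
    μ A * c ≤ (Measure.pi fun _ : Fin (k + 1) => μ) S := by
  rw [← measure_toMeasurable S, ← (measurePreserving_cons μ k).measure_preimage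
    (measurableSet_toMeasurable _ _).nullMeasurableSet]
  exact mul_le_measure_prod hA fun x hx =>
    (h x hx).trans (measure_mono fun y hy => subset_toMeasurable _ _ hy)

lemma lintegral_pi_succ_le {k : ℕ} (f : (Fin (k + 1) → Ω) → ℝ≥0∞) :
    ∫⁻ x, f x ∂(Measure.pi fun _ : Fin (k + 1) => μ) ≤
      ∫⁻ x, ∫⁻ y, f (Fin.cons x y) ∂(Measure.pi fun _ : Fin k => μ) ∂μ := by
  rw [← (measurePreserving_cons μ k).map_eq]
  exact (lintegral_map_le _ _).trans (lintegral_prod_le _)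

variable {σ : Type}

lemma pow_le_measure_loop {step : Ω → σ → Timed σ} {Good : σ → Set Ω}
    (hGood : ∀ st, MeasurableSet (Good st)) {q : ℝ≥0∞} {N : ℕ} {Inv : ℕ → σ → Prop}
    (hq : ∀ j st, j < N → Inv j st → q ≤ μ (Good st))
    (hInv : ∀ j st ω, j < N → Inv j st → ω ∈ Good st → Inv (j + 1) (step ω st).val)
    {k j : ℕ} (hjk : j + k = N) {st : σ} (hst : Inv j st) :
    q ^ k ≤ (Measure.pi fun _ : Fin k => μ)
      {τ | Inv N (Timed.loop k (fun t => step (τ t)) st).val} := by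
  induction k generalizing j st with
  | zero =>
    obtain rfl : j = N := by omega
    rw [show {τ : Fin 0 → Ω | Inv j (Timed.loop 0 (fun t => step (τ t)) st).val} = Set.univ from
      Set.eq_univ_of_forall fun _ => hst, measure_univ, pow_zero]
  | succ k ih =>
    have hj : j < N := by omega
    rw [pow_succ']
    refine (mul_le_mul_left (hq j st hj hst) _).trans
      (mul_le_measure_pi_succ (hGood st) fun ω hω => ?_)
    refine (ih (by omega) (hInv j st ω hj hst hω)).trans (measure_mono fun τ hτ => ?_)
    simpa [Timed.val_loop_succ] using hτ

lemma lintegral_steps_loop_le {step : Ω → σ → Timed σ} {B : ℝ≥0∞}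
    (hB : ∀ st, ∫⁻ ω, ((step ω st).steps : ℝ≥0∞) ∂μ ≤ B) (k : ℕ) (st : σ) :
    ∫⁻ τ, ((Timed.loop k (fun t => step (τ t)) st).steps : ℝ≥0∞)
      ∂(Measure.pi fun _ : Fin k => μ) ≤ k * (1 + B) := by
  induction k generalizing st with
  | zero => simp [Timed.loop_zero]
  | succ k ih =>
    have steps_cons (ω : Ω) (τ : Fin k → Ω) :
        ((Timed.loop (k + 1) (fun t => step ((Fin.cons ω τ : Fin (k + 1) → Ω) t)) st).steps :
          ℝ≥0∞) = 1 + ((step ω st).steps : ℝ≥0∞) +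
            ((Timed.loop k (fun t => step (τ t)) (step ω st).val).steps : ℝ≥0∞) := by
      simp [Timed.steps_loop_succ]
    refine (lintegral_pi_succ_le _).trans ?_
    calc ∫⁻ ω, ∫⁻ τ, ((Timed.loop (k + 1)
          (fun t => step ((Fin.cons ω τ : Fin (k + 1) → Ω) t)) st).steps : ℝ≥0∞)
          ∂(Measure.pi fun _ : Fin k => μ) ∂μ
        ≤ ∫⁻ ω, (1 + k * (1 + B) + ((step ω st).steps : ℝ≥0∞)) ∂μ := by
          refine lintegral_mono fun ω => ?_
          simp only [steps_cons]
          rw [lintegral_add_left measurable_const, lintegral_const, measure_univ, mul_one,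
            add_right_comm]
          gcongr
          exact ih _
      _ = 1 + k * (1 + B) + ∫⁻ ω, ((step ω st).steps : ℝ≥0∞) ∂μ := by
          rw [lintegral_add_left measurable_const, lintegral_const, measure_univ, mul_one]
      _ ≤ 1 + k * (1 + B) + B := by gcongr; exact hB st
      _ = (k + 1 : ℕ) * (1 + B) := by push_cast; ring

end Product

/-! ### Success of the estimator calls and of the random projections -/

section Calls

variable {n m p : ℕ} (E : Estimator.{u})

/-- A call of the estimator meets its error bound. -/
def CallOK (S : Matrix (Fin n) (Fin n) ℝ) (b : Fin n → ℝ) (δ : ℝ) (ω : E.Seed) : Prop :=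
  energyNorm S ((E.run S b δ ω).val - S⁻¹ *ᵥ b) ≤ δ * energyNorm S (S⁻¹ *ᵥ b)

lemma measurable_val_run {Ω : Type*} [MeasurableSpace Ω] (S : Matrix (Fin n) (Fin n) ℝ)
    (b : Fin n → ℝ) (d : ℝ) {seed : Ω → E.Seed} (hseed : Measurable seed) :
    Measurable fun ω => (E.run S b d (seed ω)).val :=
  (E.measurable_val S d).comp (measurable_const.prodMk hseed)

lemma measurable_energyNorm (S : Matrix (Fin n) (Fin n) ℝ) : Measurable (energyNorm S) :=
  (continuous_id.dotProduct (continuous_const.matrix_mulVec continuous_id)).measurable.sqrt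

lemma measurableSet_callOK (S : Matrix (Fin n) (Fin n) ℝ) (δ : ℝ) :
    MeasurableSet {x : (Fin n → ℝ) × E.Seed | CallOK E S x.1 δ x.2} := by
  have hsolve : Measurable fun x : (Fin n → ℝ) × E.Seed => S⁻¹ *ᵥ x.1 :=
    (continuous_const.matrix_mulVec continuous_id).measurable.comp measurable_fst
  exact measurableSet_le ((measurable_energyNorm S).comp ((E.measurable_val S δ).sub hsolve))
    (((measurable_energyNorm S).comp hsolve).const_mul δ)

lemma measurableSet_callOK_seed (S : Matrix (Fin n) (Fin n) ℝ) (b : Fin n → ℝ) (δ : ℝ) :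
    MeasurableSet {ω | CallOK E S b δ ω} :=
  measurable_prodMk_left (measurableSet_callOK E S δ)

variable {E} in
lemma Estimator.Reliable.le_measure {η : ℕ → ℝ} (hE : E.Reliable η)
    {S : Matrix (Fin n) (Fin n) ℝ} (hS : IsSDDM S) (b : Fin n → ℝ) {δ : ℝ} (hδ : 0 < δ) :
    ENNReal.ofReal (1 - η n) ≤ E.seedLaw {ω | CallOK E S b δ ω} :=
  (ENNReal.ofReal_le_iff_le_toReal (measure_ne_top _ _)).mpr (hE n S b δ hS hδ)

lemma mul_le_measure_pi_four {Ω : Type*} [MeasurableSpace Ω] {μ : Measure Ω}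
    [IsProbabilityMeasure μ] {A₀ A₂ A₃ : Set Ω} {A₁ : Ω → Set Ω} (h₀ : MeasurableSet A₀)
    (h₁ : ∀ x, MeasurableSet (A₁ x)) (h₂ : MeasurableSet A₂) (h₃ : MeasurableSet A₃)
    {c₁ : ℝ≥0∞} (hc₁ : ∀ x ∈ A₀, c₁ ≤ μ (A₁ x)) :
    μ A₀ * (c₁ * (μ A₂ * μ A₃)) ≤ (Measure.pi fun _ : Fin 4 => μ)
      {σ | σ 0 ∈ A₀ ∧ σ 1 ∈ A₁ (σ 0) ∧ σ 2 ∈ A₂ ∧ σ 3 ∈ A₃} := by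
  refine mul_le_measure_pi_succ h₀ fun x₀ hx₀ => (mul_le_mul_left (hc₁ x₀ hx₀) _).trans ?_
  refine mul_le_measure_pi_succ (h₁ x₀) fun x₁ hx₁ => ?_
  refine mul_le_measure_pi_succ h₂ fun x₂ hx₂ => ?_
  rw [← mul_one (μ A₃)]
  refine mul_le_measure_pi_succ h₃ fun x₃ hx₃ => ?_
  rw [← measure_univ (μ := Measure.pi fun _ : Fin 0 => μ)]
  exact measure_mono fun _ _ => ⟨hx₀, hx₁, hx₂, hx₃⟩

variable {G : SimpleGraph (Fin n)} [DecidableRel G.Adj] {ε : ℝ} (edges : EdgeList G m)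
  (δ : Precision G ε) (s : Fin n → ℝ) (r₀ : Fin p)

/-- The calls of a round whose results are used meet their error bounds. The vectors `q` and `h`
that are used come from iteration `r₀`. -/
def CallsOK (P : Fin p → Fin n → ℝ) (Q : Fin p → Fin m → ℝ) (σ : Fin p → Fin 4 → E.Seed) : Prop :=
  (∀ r, CallOK E (shiftedLap G) (Q r ᵥ* incidence edges) δ.δ₁ (σ r 2)) ∧
  (∀ r, CallOK E (shiftedLap G) (P r) δ.δ₂ (σ r 3)) ∧
  CallOK E (shiftedLap G) s δ.δ₃ (σ r₀ 0) ∧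
  CallOK E (shiftedLap G) (E.run (shiftedLap G) s δ.δ₃ (σ r₀ 0)).val δ.δ₃ (σ r₀ 1)

variable {E} {η : ℕ → ℝ}

lemma pow_four_le_measure_iteration (hE : E.Reliable η) (b b' : Fin n → ℝ) :
    ENNReal.ofReal (1 - η n) ^ 4 ≤ (Measure.pi fun _ : Fin 4 => E.seedLaw)
      {σ | CallOK E (shiftedLap G) s δ.δ₃ (σ 0) ∧
        CallOK E (shiftedLap G) (E.run (shiftedLap G) s δ.δ₃ (σ 0)).val δ.δ₃ (σ 1) ∧
        CallOK E (shiftedLap G) b δ.δ₁ (σ 2) ∧ CallOK E (shiftedLap G) b' δ.δ₂ (σ 3)} := by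
  have hS := isSDDM_shiftedLap G
  refine le_trans ?_ (mul_le_measure_pi_four (measurableSet_callOK_seed E _ s δ.δ₃)
    (A₁ := fun ω => {ω' | CallOK E _ (E.run (shiftedLap G) s δ.δ₃ ω).val δ.δ₃ ω'})
    (fun _ => measurableSet_callOK_seed E _ _ _) (measurableSet_callOK_seed E _ b δ.δ₁)
    (measurableSet_callOK_seed E _ b' δ.δ₂) fun _ _ => hE.le_measure hS _ δ.pos₃)
  calc ENNReal.ofReal (1 - η n) ^ 4 = ENNReal.ofReal (1 - η n) * (ENNReal.ofReal (1 - η n) *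
        (ENNReal.ofReal (1 - η n) * ENNReal.ofReal (1 - η n))) := by ring
    _ ≤ _ := by
        gcongr
        exacts [hE.le_measure hS s δ.pos₃, hE.le_measure hS b δ.pos₁, hE.le_measure hS b' δ.pos₂]

lemma sq_le_measure_iteration (hE : E.Reliable η) (b b' : Fin n → ℝ) :
    ENNReal.ofReal (1 - η n) ^ 2 ≤ (Measure.pi fun _ : Fin 4 => E.seedLaw)
      {σ | CallOK E (shiftedLap G) b δ.δ₁ (σ 2) ∧ CallOK E (shiftedLap G) b' δ.δ₂ (σ 3)} := by
  have hS := isSDDM_shiftedLap G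
  have h := mul_le_measure_pi_four (μ := E.seedLaw) (A₀ := Set.univ) (A₁ := fun _ => Set.univ)
    .univ (fun _ => .univ) (measurableSet_callOK_seed E (shiftedLap G) b δ.δ₁)
    (measurableSet_callOK_seed E (shiftedLap G) b' δ.δ₂) (c₁ := 1) fun _ _ => measure_univ.ge
  simp only [measure_univ, one_mul, Set.mem_univ, true_and, Set.mem_ofPred_eq] at h
  rw [sq]
  exact (mul_le_mul' (hE.le_measure hS b δ.pos₁) (hE.le_measure hS b' δ.pos₂)).trans h

lemma pow_le_measure_callsOK (hE : E.Reliable η) (P : Fin p → Fin n → ℝ)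
    (Q : Fin p → Fin m → ℝ) :
    ENNReal.ofReal (1 - η n) ^ (2 * p + 2) ≤
      (Measure.pi fun _ : Fin p => Measure.pi fun _ : Fin 4 => E.seedLaw)
        {σ | CallsOK E edges δ s r₀ P Q σ} := by
  set c := ENNReal.ofReal (1 - η n)
  let rowsOK (r : Fin p) (σ : Fin 4 → E.Seed) : Prop :=
    CallOK E (shiftedLap G) (Q r ᵥ* incidence edges) δ.δ₁ (σ 2) ∧
      CallOK E (shiftedLap G) (P r) δ.δ₂ (σ 3)
  let iterationOK (r : Fin p) : Set (Fin 4 → E.Seed) :=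
    {σ | (r = r₀ → CallOK E (shiftedLap G) s δ.δ₃ (σ 0) ∧
      CallOK E (shiftedLap G) (E.run (shiftedLap G) s δ.δ₃ (σ 0)).val δ.δ₃ (σ 1)) ∧ rowsOK r σ}
  have le_iteration (r : Fin p) : c ^ 2 * (if r = r₀ then c ^ 2 else 1) ≤
      (Measure.pi fun _ => E.seedLaw) (iterationOK r) := by
    split_ifs with hr
    · rw [← pow_add]
      exact (pow_four_le_measure_iteration δ s hE _ _).trans
        (measure_mono fun σ hσ => ⟨fun _ => ⟨hσ.1, hσ.2.1⟩, hσ.2.2⟩)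
    · rw [mul_one]
      exact (sq_le_measure_iteration δ hE _ _).trans
        (measure_mono fun σ hσ => ⟨fun h => absurd h hr, hσ⟩)
  calc c ^ (2 * p + 2) = ∏ r : Fin p, c ^ 2 * (if r = r₀ then c ^ 2 else 1) := by
        rw [Finset.prod_mul_distrib, Finset.prod_const, Finset.card_fin, Finset.prod_ite_eq',
          if_pos (Finset.mem_univ _), pow_add, pow_mul]
    _ ≤ ∏ r, (Measure.pi fun _ => E.seedLaw) (iterationOK r) :=
        Finset.prod_le_prod' fun r _ => le_iteration r
    _ = (Measure.pi fun _ => Measure.pi fun _ => E.seedLaw) (Set.univ.pi iterationOK) :=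
        (Measure.pi_pi _ _).symm
    _ ≤ (Measure.pi fun _ => Measure.pi fun _ => E.seedLaw)
          {σ | CallsOK E edges δ s r₀ P Q σ} := by
        refine measure_mono fun σ hσ => ?_
        have hσ' (r : Fin p) : σ r ∈ iterationOK r := hσ r (Set.mem_univ r)
        exact ⟨fun r => (hσ' r).2.1, fun r => (hσ' r).2.2, (hσ' r₀).1 rfl⟩

end Calls

section Projections

variable {n m d p : ℕ} {ε : ℝ}

/-- The projection preserves the squared norm of `v` up to the factor `1 ± β`. -/
def SketchOK (β : ℝ) (P : Fin p → Fin d → ℝ) (v : Fin d → ℝ) : Prop :=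
  |∑ r, (P r ⬝ᵥ v) ^ 2 - v ⬝ᵥ v| ≤ β * (v ⬝ᵥ v)

lemma measurableSet_sketchOK (β : ℝ) (v : Fin d → ℝ) :
    MeasurableSet {P : Fin p → Fin d → ℝ | SketchOK β P v} := by
  refine measurableSet_le (Continuous.measurable ?_) measurable_const
  simp only [dotProduct]
  fun_prop

lemma measurableSet_forall_sketchOK {ι : Type*} [Countable ι] (β : ℝ) (v : ι → Fin d → ℝ) :
    MeasurableSet {P : Fin p → Fin d → ℝ | ∀ i, SketchOK β P (v i)} := by
  rw [Set.ofPred_forall]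
  exact .iInter fun i => measurableSet_sketchOK β (v i)

lemma sketchDim_pos (hn : 2 ≤ n) (hε : 0 < ε) : 0 < sketchDim n ε := by
  have hlog : 0 < Real.log n := Real.log_pos (by exact_mod_cast hn)
  exact Nat.ceil_pos.mpr (by positivity)

lemma exp_sketchDim_le (hn : 0 < n) (hε : 0 < ε) :
    Real.exp (-(5 / 24) * (ε / 12) ^ 2 * sketchDim n ε) ≤ 1 / (n : ℝ) ^ 5 := by
  have hdim : 24 * Real.log n / (ε / 12) ^ 2 ≤ sketchDim n ε := Nat.le_ceil _
  rw [div_le_iff₀ (by positivity)] at hdim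
  calc Real.exp (-(5 / 24) * (ε / 12) ^ 2 * sketchDim n ε)
      ≤ Real.exp (-Real.log ((n : ℝ) ^ 5)) := by
        rw [Real.log_pow]
        push_cast
        exact Real.exp_le_exp.mpr (by linarith)
    _ = 1 / (n : ℝ) ^ 5 := by rw [Real.exp_neg, Real.exp_log (by positivity), one_div]

lemma measure_not_sketchOK_le (κ : Sketch) (hn : 2 ≤ n) (hε : 0 < ε) (hε2 : ε ≤ 1 / 2)
    (v : Fin d → ℝ) :
    (Measure.pi fun _ : Fin (sketchDim n ε) => Measure.pi fun _ : Fin d =>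
      κ.entryLaw (sketchDim n ε)) {P | ¬ SketchOK (ε / 12) P v} ≤
        ENNReal.ofReal (2 * (1 / (n : ℝ) ^ 5)) := by
  refine (johnson_lindenstrauss (sketchDim_pos hn hε) (hasSubgaussianMGF_entryLaw κ)
    (integral_entryLaw κ) (variance_entryLaw κ) v (by positivity) (by linarith)).trans ?_
  rw [ENNReal.ofReal_mul two_pos.le, ENNReal.ofReal_ofNat]
  gcongr
  exact exp_sketchDim_le (by omega) hε

lemma le_measure_forall_sketchOK (κ : Sketch) (hn : 2 ≤ n) (hε : 0 < ε) (hε2 : ε ≤ 1 / 2)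
    (v : Fin n → Fin d → ℝ) :
    ENNReal.ofReal (1 - 2 / (n : ℝ) ^ 4) ≤
      (Measure.pi fun _ : Fin (sketchDim n ε) => Measure.pi fun _ : Fin d =>
        κ.entryLaw (sketchDim n ε)) {P | ∀ i, SketchOK (ε / 12) P (v i)} := by
  have hn0 : (0 : ℝ) < n := by exact_mod_cast (by omega : 0 < n)
  set ν := Measure.pi fun _ : Fin (sketchDim n ε) => Measure.pi fun _ : Fin d =>
    κ.entryLaw (sketchDim n ε)
  have union_bound : ν {P | ∀ i, SketchOK (ε / 12) P (v i)}ᶜ ≤ ENNReal.ofReal (2 / (n : ℝ) ^ 4) :=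
    calc ν {P | ∀ i, SketchOK (ε / 12) P (v i)}ᶜ
        = ν (⋃ i, {P | ¬ SketchOK (ε / 12) P (v i)}) := by
          rw [Set.ofPred_forall, Set.compl_iInter]; rfl
      _ ≤ ∑ i, ν {P | ¬ SketchOK (ε / 12) P (v i)} := measure_iUnion_fintype_le _ _
      _ ≤ ∑ _i : Fin n, ENNReal.ofReal (2 * (1 / (n : ℝ) ^ 5)) :=
          Finset.sum_le_sum fun i _ => measure_not_sketchOK_le κ hn hε hε2 (v i)
      _ = ENNReal.ofReal (2 / (n : ℝ) ^ 4) := by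
          rw [Finset.sum_const, Finset.card_fin, nsmul_eq_mul, ← ENNReal.ofReal_natCast,
            ← ENNReal.ofReal_mul hn0.le]
          congr 1
          field_simp
  have hmeas : MeasurableSet {P : Fin (sketchDim n ε) → Fin d → ℝ |
      ∀ i, SketchOK (ε / 12) P (v i)} := measurableSet_forall_sketchOK _ v
  rw [← compl_compl {P : Fin (sketchDim n ε) → Fin d → ℝ | ∀ i, SketchOK (ε / 12) P (v i)},
    prob_compl_eq_one_sub hmeas.compl, ENNReal.ofReal_sub _ (by positivity), ENNReal.ofReal_one]
  exact tsub_le_tsub_left union_bound 1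

end Projections

section Round

variable {n m p : ℕ} {G : SimpleGraph (Fin n)} [DecidableRel G.Adj] {ε : ℝ} (E : Estimator.{u})
  (κ : Sketch) (edges : EdgeList G m) (δ : Precision G ε) (s : Fin n → ℝ) (r₀ : Fin p)

/-- The law of the randomness of one round. -/
def roundLaw (n m p : ℕ) : Measure (RoundTape n m p E.Seed) :=
  (Measure.pi fun _ => Measure.pi fun _ => κ.entryLaw p).prod
    ((Measure.pi fun _ => Measure.pi fun _ => κ.entryLaw p).prod
      (Measure.pi fun _ => Measure.pi fun _ => E.seedLaw))

instance instIsProbabilityMeasureRoundLaw : IsProbabilityMeasure (roundLaw E κ n m p) := by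
  unfold roundLaw
  infer_instance

/-- The round succeeds: the projections preserve the norms of the columns of `Ω = (I + L)⁻¹` (which
is symmetric) and of `B Ω`, and the calls whose results are used meet their error bounds. -/
def RoundOK (τ : RoundTape n m p E.Seed) : Prop :=
  (∀ i, SketchOK (ε / 12) τ.1 ((shiftedLap G)⁻¹ i)) ∧
  (∀ i, SketchOK (ε / 12) τ.2.1 (incidence edges *ᵥ (shiftedLap G)⁻¹ i)) ∧
  CallsOK E edges δ s r₀ τ.1 τ.2.1 τ.2.2

lemma measurable_seed (r : Fin p) (i : Fin 4) :
    Measurable fun τ : RoundTape n m p E.Seed => τ.2.2 r i := by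
  fun_prop

lemma measurableSet_callsOK :
    MeasurableSet {τ : RoundTape n m p E.Seed | CallsOK E edges δ s r₀ τ.1 τ.2.1 τ.2.2} := by
  have measurableSet_call {b : RoundTape n m p E.Seed → Fin n → ℝ} (hb : Measurable b) (d : ℝ)
      (r : Fin p) (a : Fin 4) : MeasurableSet {τ | CallOK E (shiftedLap G) (b τ) d (τ.2.2 r a)} :=
    (hb.prodMk (measurable_seed E r a)) (measurableSet_callOK E _ d)
  have measurable_QB (r : Fin p) :
      Measurable fun τ : RoundTape n m p E.Seed => τ.2.1 r ᵥ* incidence edges :=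
    (continuous_id.matrix_vecMul continuous_const).measurable.comp (by fun_prop)
  have measurable_q :
      Measurable fun τ : RoundTape n m p E.Seed => (E.run (shiftedLap G) s δ.δ₃ (τ.2.2 r₀ 0)).val :=
    measurable_val_run E _ _ _ (measurable_seed E r₀ 0)
  simp only [CallsOK, Set.ofPred_and, Set.ofPred_forall]
  exact (MeasurableSet.iInter fun r => measurableSet_call (measurable_QB r) _ r 2).inter
    ((MeasurableSet.iInter fun r => measurableSet_call (by fun_prop) _ r 3).inter
      ((measurableSet_call measurable_const _ r₀ 0).inter (measurableSet_call measurable_q _ r₀ 1)))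

lemma measurableSet_roundOK : MeasurableSet {τ | RoundOK E edges δ s r₀ τ} :=
  (measurable_fst (measurableSet_forall_sketchOK _ _)).inter
    (((measurable_fst.comp measurable_snd) (measurableSet_forall_sketchOK _ _)).inter
      (measurableSet_callsOK E edges δ s r₀))

lemma one_sub_one_div_sq_le {x : ℝ} (hx : 2 ≤ x) :
    1 - 1 / x ^ 2 ≤ (1 - 2 / x ^ 4) * (1 - 2 / x ^ 4) := by
  have h : 4 / x ^ 4 ≤ 1 / x ^ 2 := by
    rw [div_le_div_iff₀ (by positivity) (by positivity)]
    nlinarith [sq_nonneg x, mul_le_mul_of_nonneg_right (show 4 ≤ x ^ 2 by nlinarith) (sq_nonneg x)]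
  calc 1 - 1 / x ^ 2 ≤ 1 - 4 / x ^ 4 + (2 / x ^ 4) ^ 2 := by linarith [sq_nonneg (2 / x ^ 4)]
    _ = (1 - 2 / x ^ 4) * (1 - 2 / x ^ 4) := by ring

variable {E} in
lemma le_measure_roundOK (hn : 2 ≤ n) (hε : 0 < ε) (hε2 : ε ≤ 1 / 2) {η : ℕ → ℝ}
    (hE : E.Reliable η) (r₀ : Fin (sketchDim n ε)) :
    ENNReal.ofReal (1 - 1 / (n : ℝ) ^ 2) * ENNReal.ofReal (1 - η n) ^ (2 * sketchDim n ε + 2) ≤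
      roundLaw E κ n m (sketchDim n ε) {τ | RoundOK E edges δ s r₀ τ} := by
  have hn2 : (2 : ℝ) ≤ n := by exact_mod_cast hn
  have hfail : 2 / (n : ℝ) ^ 4 ≤ 1 := by
    rw [div_le_one (by positivity)]
    exact le_self_pow₀ (by linarith) (by norm_num) |>.trans' hn2
  calc ENNReal.ofReal (1 - 1 / (n : ℝ) ^ 2) * ENNReal.ofReal (1 - η n) ^ (2 * sketchDim n ε + 2)
      ≤ ENNReal.ofReal (1 - 2 / (n : ℝ) ^ 4) * (ENNReal.ofReal (1 - 2 / (n : ℝ) ^ 4) *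
          ENNReal.ofReal (1 - η n) ^ (2 * sketchDim n ε + 2)) := by
        rw [← mul_assoc, ← ENNReal.ofReal_mul (sub_nonneg.mpr hfail)]
        gcongr
        exact one_sub_one_div_sq_le hn2
    _ ≤ _ := by
        refine (mul_le_mul_left (le_measure_forall_sketchOK κ hn hε hε2
          fun i => (shiftedLap G)⁻¹ i) _).trans
            (mul_le_measure_prod (measurableSet_forall_sketchOK _ _) fun P hP => ?_)
        refine (mul_le_mul_left (le_measure_forall_sketchOK κ hn hε hε2
          fun i => incidence edges *ᵥ (shiftedLap G)⁻¹ i) _).trans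
            (mul_le_measure_prod (measurableSet_forall_sketchOK _ _) fun Q hQ => ?_)
        exact (pow_le_measure_callsOK edges δ s r₀ hE P Q).trans
          (measure_mono fun σ hσ => ⟨hP, hQ, hσ⟩)

end Round

/-! ### Greedy minimization of nonnegative quadratic forms -/

section ZeroOn

variable {ι : Type*} [DecidableEq ι] {s : ι → ℝ}

/-- The vector `s` with the entries in `T` replaced by `0`, written `s^T` in the paper. -/
def zeroOn (T : Finset ι) (s : ι → ℝ) : ι → ℝ := T.piecewise 0 s

lemma zeroOn_empty (s : ι → ℝ) : zeroOn ∅ s = s := Finset.piecewise_empty _ _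

lemma zeroOn_insert (i : ι) (T : Finset ι) (s : ι → ℝ) :
    zeroOn (insert i T) s = Function.update (zeroOn T s) i 0 := T.piecewise_insert _ _ i

lemma zeroOn_nonneg (hs : 0 ≤ s) (T : Finset ι) : 0 ≤ zeroOn T s :=
  T.le_piecewise_of_le_of_le le_rfl hs

lemma zeroOn_le_of_subset (hs : 0 ≤ s) {T U : Finset ι} (h : T ⊆ U) :
    zeroOn U s ≤ zeroOn T s := fun i => by
  by_cases hT : i ∈ T
  · simp [zeroOn, hT, h hT]
  · rw [zeroOn, zeroOn, T.piecewise_eq_of_notMem _ _ hT]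
    exact U.piecewise_le_of_le_of_le hs le_rfl i

end ZeroOn

section Quadratic

variable {ι : Type*} [Fintype ι] {M : Matrix ι ι ℝ} {s s' : ι → ℝ}

/-- The quadratic form `sᵀ M s` of a matrix. -/
def quad (M : Matrix ι ι ℝ) (s : ι → ℝ) : ℝ := s ⬝ᵥ (M *ᵥ s)

/-- The marginal gain of `i`: for symmetric `M`, the decrease of `sᵀ M s` when `s i` is replaced by
`0`. -/
def gain (M : Matrix ι ι ℝ) (s : ι → ℝ) (i : ι) : ℝ := s i * (2 * (M *ᵥ s) i - M i i * s i)

lemma gain_of_apply_eq_zero {i : ι} (hi : s i = 0) : gain M s i = 0 := by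
  rw [gain, hi, zero_mul]

lemma quad_le_quad (hM : ∀ i j, 0 ≤ M i j) (hs : 0 ≤ s) (h : s ≤ s') : quad M s ≤ quad M s' :=
  Finset.sum_le_sum fun i _ => mul_le_mul (h i)
    (Finset.sum_le_sum fun j _ => mul_le_mul_of_nonneg_left (h j) (hM i j))
    (dotProduct_nonneg_of_nonneg (hM i) hs) ((hs i).trans (h i))

lemma diag_mul_le_mulVec (hM : ∀ i j, 0 ≤ M i j) (hs : 0 ≤ s) (i : ι) :
    M i i * s i ≤ (M *ᵥ s) i :=
  Finset.single_le_sum (f := fun j => M i j * s j) (fun j _ => mul_nonneg (hM i j) (hs j))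
    (Finset.mem_univ i)

lemma gain_nonneg (hM : ∀ i j, 0 ≤ M i j) (hs : 0 ≤ s) (i : ι) : 0 ≤ gain M s i := by
  have hdiag := diag_mul_le_mulVec hM hs i
  exact mul_nonneg (hs i) (by linarith [mul_nonneg (hM i i) (hs i)])

lemma gain_le_gain (hM : ∀ i j, 0 ≤ M i j) (hs : 0 ≤ s) (h : s ≤ s') {i : ι} (hi : s i = s' i) :
    gain M s i ≤ gain M s' i := by
  have hmul : (M *ᵥ s) i ≤ (M *ᵥ s') i :=
    Finset.sum_le_sum fun j _ => mul_le_mul_of_nonneg_left (h j) (hM i j)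
  rw [gain, gain, ← hi]
  exact mul_le_mul_of_nonneg_left (by linarith) (hs i)

variable [DecidableEq ι]

lemma quad_sub_quad_update (hM : M.IsSymm) (s : ι → ℝ) (i : ι) :
    quad M s - quad M (Function.update s i 0) = gain M s i := by
  have hupdate : Function.update s i 0 = s - Pi.single i (s i) := by
    ext j
    rcases eq_or_ne j i with rfl | h <;> simp [*]
  have hsymm : (s ᵥ* M) i = (M *ᵥ s) i := by rw [← Matrix.mulVec_transpose, hM.eq]
  have hdiag : (M *ᵥ Pi.single i (s i)) i = M i i * s i := dotProduct_single _ _ _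
  have hcross : s ⬝ᵥ (M *ᵥ Pi.single i (s i)) = (M *ᵥ s) i * s i := by
    rw [Matrix.dotProduct_mulVec, dotProduct_single, hsymm]
  simp only [quad, gain, hupdate, Matrix.mulVec_sub, sub_dotProduct, dotProduct_sub,
    single_dotProduct, hdiag, hcross]
  ring

lemma quad_sub_quad_insert (hM : M.IsSymm) (s : ι → ℝ) (T : Finset ι) (i : ι) :
    quad M (zeroOn T s) - quad M (zeroOn (insert i T) s) = gain M (zeroOn T s) i := by
  rw [zeroOn_insert, quad_sub_quad_update hM]

lemma quad_sub_quad_union_le (hM : M.IsSymm) (hM0 : ∀ i j, 0 ≤ M i j) (hs : 0 ≤ s)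
    (T A : Finset ι) :
    quad M (zeroOn T s) - quad M (zeroOn (T ∪ A) s) ≤
      ∑ i ∈ A, gain M (zeroOn T s) i := by
  induction A using Finset.induction_on with
  | empty => rw [Finset.union_empty, sub_self, Finset.sum_empty]
  | insert a A ha ih =>
    have hstep := quad_sub_quad_insert hM s (T ∪ A) a
    have hgain : gain M (zeroOn (T ∪ A) s) a ≤ gain M (zeroOn T s) a :=
      gain_le_gain hM0 (zeroOn_nonneg hs _)
        (zeroOn_le_of_subset hs Finset.subset_union_left) (by simp [zeroOn, Finset.piecewise, ha])
    rw [Finset.union_insert, Finset.sum_insert ha]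
    linarith

lemma quad_insert_sub_le (hM : M.IsSymm) (hM0 : ∀ i j, 0 ≤ M i j) (hs : 0 ≤ s) {k : ℕ}
    (hk : 0 < k) {ε : ℝ} (hε : ε ≤ 1) {T U : Finset ι} (hU : U.card ≤ k) {i : ι}
    (hi : ∀ j ∉ T, (1 - ε) * gain M (zeroOn T s) j ≤ gain M (zeroOn T s) i) :
    quad M (zeroOn (insert i T) s) - quad M (zeroOn U s) ≤
      (1 - (1 - ε) / k) * (quad M (zeroOn T s) - quad M (zeroOn U s)) := by
  have hgain := gain_nonneg hM0 (zeroOn_nonneg hs T) i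
  have hmax (j : ι) : (1 - ε) * gain M (zeroOn T s) j ≤ gain M (zeroOn T s) i := by
    by_cases hj : j ∈ T
    · rwa [gain_of_apply_eq_zero (T.piecewise_eq_of_mem _ _ hj), mul_zero]
    · exact hi j hj
  have hdecrease : (1 - ε) * (quad M (zeroOn T s) - quad M (zeroOn U s)) ≤
      gain M (zeroOn T s) i * k :=
    calc (1 - ε) * (quad M (zeroOn T s) - quad M (zeroOn U s))
        ≤ (1 - ε) * (quad M (zeroOn T s) - quad M (zeroOn (T ∪ U) s)) := by
          have := quad_le_quad hM0 (zeroOn_nonneg hs _)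
            (zeroOn_le_of_subset hs (Finset.subset_union_right : U ⊆ T ∪ U))
          exact mul_le_mul_of_nonneg_left (by linarith) (by linarith)
      _ ≤ (1 - ε) * ∑ j ∈ U, gain M (zeroOn T s) j := by
          exact mul_le_mul_of_nonneg_left (quad_sub_quad_union_le hM hM0 hs T U) (by linarith)
      _ ≤ ∑ _j ∈ U, gain M (zeroOn T s) i := by
          rw [Finset.mul_sum]
          exact Finset.sum_le_sum fun j _ => hmax j
      _ = gain M (zeroOn T s) i * U.card := by rw [Finset.sum_const, nsmul_eq_mul, mul_comm]
      _ ≤ gain M (zeroOn T s) i * k := by gcongr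
  have hstep := quad_sub_quad_insert hM s T i
  have hdiv := (div_le_iff₀ (by exact_mod_cast hk)).mpr hdecrease
  rw [mul_div_right_comm] at hdiv
  linarith

end Quadratic

lemma greedy_factor_le {k : ℕ} (hk : 0 < k) {ε : ℝ} (hε0 : 0 ≤ ε) (hε : ε ≤ 1 / 2) :
    (1 - (1 - ε) / k) ^ k ≤ 1 / Real.exp 1 + ε := by
  have hk' : (1 : ℝ) ≤ k := by exact_mod_cast hk
  have hfactor : 0 ≤ 1 - (1 - ε) / k := by
    rw [sub_nonneg, div_le_one (by linarith)]
    linarith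
  have hexp : Real.exp ε ≤ 1 + ε + ε ^ 2 := by
    have := Real.abs_exp_sub_one_sub_id_le (x := ε) (by rw [abs_of_nonneg hε0]; linarith)
    linarith [(abs_le.mp this).2]
  have two_le_e : (2 : ℝ) ≤ Real.exp 1 := by linarith [Real.add_one_le_exp (1 : ℝ)]
  calc (1 - (1 - ε) / k) ^ k ≤ Real.exp (-((1 - ε) / k)) ^ k := by
        gcongr
        linarith [Real.add_one_le_exp (-((1 - ε) / k))]
    _ = Real.exp ε / Real.exp 1 := by
        rw [← Real.exp_nat_mul, ← Real.exp_sub]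
        congr 1
        field_simp
        ring
    _ ≤ 1 / Real.exp 1 + ε := by
        rw [div_add' _ _ _ (Real.exp_pos 1).ne']
        gcongr
        nlinarith

section Conflict

variable {n : ℕ} (G : SimpleGraph (Fin n)) [DecidableRel G.Adj] (o : Objective)

/-- The matrix `M` for which the conflict measure is `sᵀ M s`: `Ω` for resistance and `Ω²` for
controversy. -/
def conflictMatrix : Matrix (Fin n) (Fin n) ℝ :=
  match o with
  | .resistance => (shiftedLap G)⁻¹
  | .controversy => (shiftedLap G)⁻¹ * (shiftedLap G)⁻¹

lemma isSymm_conflictMatrix : (conflictMatrix G o).IsSymm := by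
  cases o with
  | resistance => exact isSymm_omega G
  | controversy => rw [Matrix.IsSymm, conflictMatrix, Matrix.transpose_mul, (isSymm_omega G).eq]

variable {G} in
lemma conflictMatrix_nonneg (i j : Fin n) : 0 ≤ conflictMatrix G o i j := by
  cases o with
  | resistance => exact omega_nonneg G i j
  | controversy =>
    rw [conflictMatrix, Matrix.mul_apply]
    exact Finset.sum_nonneg fun l _ => mul_nonneg (omega_nonneg G i l) (omega_nonneg G l j)

lemma objective_eq_quad (s : Fin n → ℝ) (T : Finset (Fin n)) :
    objective G o s T = quad (conflictMatrix G o) (zeroOn T s) := by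
  cases o with
  | resistance => rfl
  | controversy =>
    change _ = zeroOn T s ⬝ᵥ (((shiftedLap G)⁻¹ * (shiftedLap G)⁻¹) *ᵥ zeroOn T s)
    rw [← Matrix.mulVec_mulVec, Matrix.dotProduct_mulVec, ← Matrix.mulVec_transpose,
      (isSymm_omega G).eq]
    rfl

end Conflict

/-! ### Accuracy of the estimated gains -/

section Perturbation

lemma dotProduct_self_nonneg {ι : Type*} [Fintype ι] (v : ι → ℝ) : 0 ≤ v ⬝ᵥ v :=
  Finset.sum_nonneg fun i _ => mul_self_nonneg (v i)

lemma abs_sum_sq_sub_sum_sq_le {ι : Type*} (I : Finset ι) (x y : ι → ℝ) :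
    |∑ r ∈ I, y r ^ 2 - ∑ r ∈ I, x r ^ 2| ≤
      2 * √((∑ r ∈ I, x r ^ 2) * ∑ r ∈ I, (y r - x r) ^ 2) + ∑ r ∈ I, (y r - x r) ^ 2 := by
  have hsplit : ∑ r ∈ I, y r ^ 2 - ∑ r ∈ I, x r ^ 2 =
      2 * ∑ r ∈ I, x r * (y r - x r) + ∑ r ∈ I, (y r - x r) ^ 2 := by
    rw [Finset.mul_sum, ← Finset.sum_add_distrib, ← Finset.sum_sub_distrib]
    exact Finset.sum_congr rfl fun r _ => by ring
  have cauchy_schwarz : |∑ r ∈ I, x r * (y r - x r)| ≤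
      √((∑ r ∈ I, x r ^ 2) * ∑ r ∈ I, (y r - x r) ^ 2) :=
    Real.abs_le_sqrt (Finset.sum_mul_sq_le_sq_mul_sq _ _ _)
  calc |∑ r ∈ I, y r ^ 2 - ∑ r ∈ I, x r ^ 2|
      ≤ |2 * ∑ r ∈ I, x r * (y r - x r)| + |∑ r ∈ I, (y r - x r) ^ 2| := by
        rw [hsplit]
        exact abs_add_le _ _
    _ ≤ _ := by
        rw [abs_mul, abs_two, abs_of_nonneg (Finset.sum_nonneg fun r _ => sq_nonneg (y r - x r))]
        gcongr

lemma abs_sum_sq_sub_sum_sq_le_mul {ι : Type*} {I : Finset ι} {x y : ι → ℝ} {c ε : ℝ}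
    (hε : 0 ≤ ε) (hε2 : ε ≤ 1 / 2) (hx : ∑ r ∈ I, x r ^ 2 ≤ (1 + ε / 12) * c)
    (hxy : ∑ r ∈ I, (y r - x r) ^ 2 ≤ (ε / 32) ^ 2 * c) :
    |∑ r ∈ I, y r ^ 2 - ∑ r ∈ I, x r ^ 2| ≤ ε / 14 * c := by
  have hx0 : 0 ≤ ∑ r ∈ I, x r ^ 2 := Finset.sum_nonneg fun r _ => sq_nonneg _
  have hc : 0 ≤ c := (mul_nonneg_iff_of_pos_left (by linarith)).mp (hx0.trans hx)
  have hsqrt : √((∑ r ∈ I, x r ^ 2) * ∑ r ∈ I, (y r - x r) ^ 2) ≤ 103 / 100 * (ε / 32) * c := by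
    refine Real.sqrt_le_iff.mpr ⟨by positivity, ?_⟩
    calc (∑ r ∈ I, x r ^ 2) * ∑ r ∈ I, (y r - x r) ^ 2
        ≤ ((1 + ε / 12) * c) * ((ε / 32) ^ 2 * c) :=
          mul_le_mul hx hxy (Finset.sum_nonneg fun r _ => sq_nonneg _) (by positivity)
      _ = (1 + ε / 12) * ((ε / 32) * c) ^ 2 := by ring
      _ ≤ (103 / 100) ^ 2 * ((ε / 32) * c) ^ 2 := by gcongr; linarith
      _ = (103 / 100 * (ε / 32) * c) ^ 2 := by ring
  have hsq : (ε / 32) ^ 2 * c ≤ ε / 2048 * c := by gcongr; nlinarith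
  have hεc : 0 ≤ ε * c := mul_nonneg hε hc
  linarith [abs_sum_sq_sub_sum_sq_le I x y]

lemma abs_gain_error_le {σ q q' D D' c c' : ℝ} (hσ : 0 ≤ σ) (hq : D * σ ≤ q)
    (hc : 0 ≤ c) (hc' : 0 ≤ c') (hq' : |q' - q| ≤ c * q) (hD' : |D' - D| ≤ c' * D) :
    |σ * (2 * q' - D' * σ) - σ * (2 * q - D * σ)| ≤
      (2 * c + c') * (σ * (2 * q - D * σ)) := by
  calc |σ * (2 * q' - D' * σ) - σ * (2 * q - D * σ)|
      = σ * |2 * (q' - q) - (D' - D) * σ| := by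
        rw [← abs_of_nonneg hσ, ← abs_mul, abs_of_nonneg hσ]
        ring_nf
    _ ≤ σ * (2 * (c * q) + c' * D * σ) := by
        gcongr
        refine (abs_sub _ _).trans ?_
        rw [abs_mul, abs_mul, abs_two, abs_of_nonneg hσ]
        gcongr
    _ ≤ σ * ((2 * c + c') * (2 * q - D * σ)) := by
        gcongr
        nlinarith [mul_le_mul_of_nonneg_left hq hc, mul_le_mul_of_nonneg_left hq hc']
    _ = _ := by ring

end Perturbation

section Accuracy

variable {n m p : ℕ} {G : SimpleGraph (Fin n)} [DecidableRel G.Adj] {ε : ℝ}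

lemma energyNorm_equilibrium_le {b : Fin n → ℝ} (hb : 0 ≤ b) :
    energyNorm (shiftedLap G) (equilibrium G b) ≤ ∑ i, b i := by
  have hle (i : Fin n) : ∑ j, (shiftedLap G)⁻¹ i j * b j ≤ ∑ j, b j :=
    Finset.sum_le_sum fun j _ => mul_le_of_le_one_left (hb j) (omega_le_one G i j)
  refine (sq_le_sq₀ (energyNorm_nonneg _ _) (Finset.sum_nonneg fun i _ => hb i)).mp ?_
  rw [sq_energyNorm (posDef_shiftedLap G).posSemidef, shiftedLap_mulVec_equilibrium, pow_two,
    Finset.mul_sum]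
  exact Finset.sum_le_sum fun i _ => mul_le_mul_of_nonneg_right (hle i) (hb i)

lemma sum_le_det_mul_equilibrium (hG : G.Connected) {b : Fin n → ℝ} (hb : 0 ≤ b) (i : Fin n) :
    ∑ j, b j ≤ (shiftedLap G).det * equilibrium G b i := by
  change _ ≤ (shiftedLap G).det * ∑ j, (shiftedLap G)⁻¹ i j * b j
  rw [Finset.mul_sum]
  gcongr with j
  rw [← mul_assoc]
  exact le_mul_of_one_le_left (hb j) (one_le_det_mul_omega hG i j)

variable (G) in
lemma delta₃Bound_mul_det_le (hn : 2 ≤ n) (hε : 0 ≤ ε) :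
    delta₃Bound G ε * (shiftedLap G).det ≤ ε / 12 := by
  have hdet := det_shiftedLap_pos G
  have hn2 : (2 : ℝ) ≤ n := by exact_mod_cast hn
  have hsqrt : 2 ≤ √(n * (1 + n) : ℝ) := Real.le_sqrt_of_sq_le (by nlinarith)
  calc delta₃Bound G ε * (shiftedLap G).det = ε / (6 * √(n * (1 + n))) := by
        rw [delta₃Bound]
        field_simp
    _ ≤ ε / (6 * 2) := by gcongr
    _ = ε / 12 := by norm_num

lemma abs_sub_equilibrium_le (hn : 2 ≤ n) (hG : G.Connected) (hε : 0 ≤ ε) {δ : ℝ} (hδ : 0 ≤ δ)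
    (hδ3 : δ ≤ delta₃Bound G ε) {b y : Fin n → ℝ} (hb : 0 ≤ b)
    (hy : energyNorm (shiftedLap G) (y - equilibrium G b) ≤
      δ * energyNorm (shiftedLap G) (equilibrium G b)) (i : Fin n) :
    |y i - equilibrium G b i| ≤ ε / 12 * equilibrium G b i :=
  calc |y i - equilibrium G b i| ≤ energyNorm (shiftedLap G) (y - equilibrium G b) :=
        abs_apply_le_energyNorm (y - equilibrium G b) i
    _ ≤ δ * ∑ j, b j := hy.trans (by gcongr; exact energyNorm_equilibrium_le hb)
    _ ≤ δ * ((shiftedLap G).det * equilibrium G b i) := by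
        gcongr
        exact sum_le_det_mul_equilibrium hG hb i
    _ ≤ delta₃Bound G ε * (shiftedLap G).det * equilibrium G b i := by
        rw [← mul_assoc]
        have := (det_shiftedLap_pos G).le
        have := equilibrium_nonneg (G := G) hb i
        gcongr
    _ ≤ ε / 12 * equilibrium G b i :=
        mul_le_mul_of_nonneg_right (delta₃Bound_mul_det_le G hn hε) (equilibrium_nonneg hb i)

lemma delta₁Bound_le_delta₂Bound (hn : 0 < n) (hε : 0 ≤ ε) :
    delta₁Bound n ε ≤ delta₂Bound n ε := by
  have hn1 : (1 : ℝ) ≤ n := by exact_mod_cast hn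
  have hfactor : delta₁Bound n ε = delta₂Bound n ε * ((n - 1) / n ^ 2) := by
    unfold delta₁Bound delta₂Bound
    field_simp
  rw [hfactor]
  refine mul_le_of_le_one_right (by unfold delta₂Bound; positivity) ?_
  rw [div_le_one (by positivity)]
  nlinarith

lemma sq_delta₂Bound_mul_le (hn : 0 < n) (hε : 0 ≤ ε) (hε2 : ε ≤ 12) :
    delta₂Bound n ε ^ 2 * ((n + 1) * (n * (1 + ε / 12))) ≤
      (ε / 32) ^ 2 * (1 / ((n : ℝ) + 1)) ^ 2 := by
  have hsq : delta₂Bound n ε ^ 2 * ((n + 1) * (n * (1 + ε / 12))) =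
      (ε / 32) ^ 2 * (1 / ((n : ℝ) + 1)) ^ 2 * (1 - ε / 12) := by
    have : 1 + ε / 12 ≠ 0 := by positivity
    rw [delta₂Bound, div_pow, mul_pow, mul_pow, Real.sq_sqrt (by linarith),
      Real.sq_sqrt (by positivity)]
    field_simp
  rw [hsq]
  exact mul_le_of_le_one_right (by positivity) (by linarith)

lemma sum_sq_sub_equilibrium_le (hn : 0 < n) (hε : 0 ≤ ε) (hε2 : ε ≤ 12) {δ : ℝ} (hδ : 0 ≤ δ)
    (hδ2 : δ ≤ delta₂Bound n ε) {b y : Fin p → Fin n → ℝ}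
    (hy : ∀ r, energyNorm (shiftedLap G) (y r - equilibrium G (b r)) ≤
      δ * energyNorm (shiftedLap G) (equilibrium G (b r)))
    (hb : ∀ i, ∑ r, equilibrium G (b r) i ^ 2 ≤ 1 + ε / 12) (i : Fin n) :
    ∑ r, (y r i - equilibrium G (b r) i) ^ 2 ≤ (ε / 32) ^ 2 * (1 / ((n : ℝ) + 1)) ^ 2 := by
  have hentry (r : Fin p) : (y r i - equilibrium G (b r) i) ^ 2 ≤
      δ ^ 2 * ((n + 1) * (equilibrium G (b r) ⬝ᵥ equilibrium G (b r))) := by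
    have habs := (abs_apply_le_energyNorm (y r - equilibrium G (b r)) i).trans (hy r)
    have hsq := pow_le_pow_left₀ (abs_nonneg _) habs 2
    rw [sq_abs, mul_pow, sq_energyNorm (posDef_shiftedLap G).posSemidef] at hsq
    exact hsq.trans (by gcongr; exact energy_le _)
  calc ∑ r, (y r i - equilibrium G (b r) i) ^ 2
      ≤ ∑ r, δ ^ 2 * ((n + 1) * (equilibrium G (b r) ⬝ᵥ equilibrium G (b r))) :=
        Finset.sum_le_sum fun r _ => hentry r
    _ = δ ^ 2 * ((n + 1) * ∑ j, ∑ r, equilibrium G (b r) j ^ 2) := by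
        rw [← Finset.mul_sum, ← Finset.mul_sum, Finset.sum_comm]
        simp only [dotProduct, pow_two]
    _ ≤ delta₂Bound n ε ^ 2 * ((n + 1) * ∑ _j : Fin n, (1 + ε / 12)) := by
        gcongr with j
        exact hb j
    _ = delta₂Bound n ε ^ 2 * ((n + 1) * (n * (1 + ε / 12))) := by
        rw [Finset.sum_const, Finset.card_univ, Fintype.card_fin, nsmul_eq_mul]
    _ ≤ _ := sq_delta₂Bound_mul_le hn hε hε2

lemma abs_sum_sq_sub_le (hn : 0 < n) (hε : 0 ≤ ε) (hε2 : ε ≤ 1 / 2) {δ : ℝ} (hδ : 0 ≤ δ)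
    (hδ2 : δ ≤ delta₂Bound n ε) {b y : Fin p → Fin n → ℝ}
    (hy : ∀ r, energyNorm (shiftedLap G) (y r - equilibrium G (b r)) ≤
      δ * energyNorm (shiftedLap G) (equilibrium G (b r)))
    {w : Fin n → ℝ} (hw : ∀ j, w j ≤ 1)
    (hb : ∀ j, |∑ r, equilibrium G (b r) j ^ 2 - w j| ≤ ε / 12 * w j)
    {i : Fin n} {c : ℝ} (hwc : w i ≤ c) (hc : (1 / ((n : ℝ) + 1)) ^ 2 ≤ c) :
    |∑ r, y r i ^ 2 - w i| ≤ ε / 12 * w i + ε / 14 * c := by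
  have hle (j : Fin n) : ∑ r, equilibrium G (b r) j ^ 2 ≤ (1 + ε / 12) * w j := by
    linarith [(abs_le.mp (hb j)).2]
  have hrounding : |∑ r, y r i ^ 2 - ∑ r, equilibrium G (b r) i ^ 2| ≤ ε / 14 * c :=
    abs_sum_sq_sub_sum_sq_le_mul hε hε2 ((hle i).trans (by gcongr))
      ((sum_sq_sub_equilibrium_le hn hε (by linarith) hδ hδ2 hy
        (fun j => (hle j).trans (mul_le_of_le_one_right (by positivity) (hw j))) i).trans
        (by gcongr))
  linarith [hb i, abs_sub_le (∑ r, y r i ^ 2) (∑ r, equilibrium G (b r) i ^ 2) (w i)]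

lemma abs_equilibrium_sub_le {x y : Fin n → ℝ} {c : ℝ} (hxy : ∀ j, |y j - x j| ≤ c * x j)
    (i : Fin n) : |equilibrium G y i - equilibrium G x i| ≤ c * equilibrium G x i := by
  have hsub : equilibrium G y i - equilibrium G x i =
      ∑ j, (shiftedLap G)⁻¹ i j * (y j - x j) := by
    simp only [equilibrium, Matrix.mulVec, dotProduct, mul_sub, Finset.sum_sub_distrib]
  calc |equilibrium G y i - equilibrium G x i|
      ≤ ∑ j, |(shiftedLap G)⁻¹ i j * (y j - x j)| := hsub ▸ Finset.abs_sum_le_sum_abs _ _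
    _ ≤ ∑ j, (shiftedLap G)⁻¹ i j * (c * x j) := Finset.sum_le_sum fun j _ => by
        rw [abs_mul, abs_of_nonneg (omega_nonneg G i j)]
        exact mul_le_mul_of_nonneg_left (hxy j) (omega_nonneg G i j)
    _ = c * equilibrium G x i := by
        simp only [equilibrium, Matrix.mulVec, dotProduct, Finset.mul_sum, mul_left_comm]

variable {E : Estimator.{u}} {o : Objective} {edges : EdgeList G m} {δ : Precision G ε}
  {s : Fin n → ℝ} {r₀ : Fin p} {τ : RoundTape n m p E.Seed}

lemma abs_solveQ_sub_le (hn : 2 ≤ n) (hG : G.Connected) (hε : 0 ≤ ε) (hs : 0 ≤ s)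
    (hτ : RoundOK E edges δ s r₀ τ) (i : Fin n) :
    |(solveQ E δ s τ r₀).val i - equilibrium G s i| ≤ ε / 12 * equilibrium G s i := by
  obtain ⟨-, -, -, -, hcall, -⟩ := hτ
  exact abs_sub_equilibrium_le hn hG hε δ.pos₃.le δ.le₃ hs hcall i

lemma abs_solveH_sub_le (hn : 2 ≤ n) (hG : G.Connected) (hε : 0 ≤ ε) (hε2 : ε ≤ 1 / 2)
    (hs : 0 ≤ s) (hτ : RoundOK E edges δ s r₀ τ) (i : Fin n) :
    |(solveH E δ s τ r₀).val i - equilibrium G (equilibrium G s) i| ≤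
      (ε / 6 + ε / 288) * equilibrium G (equilibrium G s) i := by
  have hq := abs_solveQ_sub_le hn hG hε hs hτ
  have hq0 : 0 ≤ (solveQ E δ s τ r₀).val := fun j => by
    have := equilibrium_nonneg (G := G) hs j
    dsimp only [Pi.zero_apply] at this ⊢
    nlinarith [(abs_le.mp (hq j)).1]
  have hcall := abs_sub_equilibrium_le hn hG hε δ.pos₃.le δ.le₃ hq0 hτ.2.2.2.2.2 i
  have hexact := abs_equilibrium_sub_le (G := G) hq i
  have hz : 0 ≤ equilibrium G (equilibrium G s) i := equilibrium_nonneg (equilibrium_nonneg hs) i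
  have hsq : ε / 12 * (ε / 12) ≤ ε / 288 := by nlinarith
  calc |(solveH E δ s τ r₀).val i - equilibrium G (equilibrium G s) i|
      ≤ ε / 12 * equilibrium G (solveQ E δ s τ r₀).val i +
          ε / 12 * equilibrium G (equilibrium G s) i :=
        (abs_sub_le _ _ _).trans (add_le_add hcall hexact)
    _ ≤ ε / 12 * ((1 + ε / 12) * equilibrium G (equilibrium G s) i) +
          ε / 12 * equilibrium G (equilibrium G s) i := by
        gcongr
        linarith [(abs_le.mp hexact).2]
    _ = (ε / 6 + ε / 12 * (ε / 12)) * equilibrium G (equilibrium G s) i := by ring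
    _ ≤ _ := by gcongr

lemma abs_sum_sq_solveY_sub_le (hn : 0 < n) (hε : 0 ≤ ε) (hε2 : ε ≤ 1 / 2)
    (hτ : RoundOK E edges δ s r₀ τ) (i : Fin n) :
    |∑ r, (solveY E δ τ r).val i ^ 2 - (shiftedLap G)⁻¹ i ⬝ᵥ (shiftedLap G)⁻¹ i| ≤
      (ε / 12 + ε / 14) * ((shiftedLap G)⁻¹ i ⬝ᵥ (shiftedLap G)⁻¹ i) := by
  obtain ⟨hP, -, -, hcalls, -⟩ := hτ
  have le_one (j : Fin n) : (shiftedLap G)⁻¹ j ⬝ᵥ (shiftedLap G)⁻¹ j ≤ 1 := by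
    have hB := dotProduct_self_nonneg (incidence edges *ᵥ (shiftedLap G)⁻¹ j)
    linarith [omega_self_eq edges j, omega_le_one G j j]
  have hdiag : (1 / ((n : ℝ) + 1)) ^ 2 ≤ (shiftedLap G)⁻¹ i ⬝ᵥ (shiftedLap G)⁻¹ i :=
    calc (1 / ((n : ℝ) + 1)) ^ 2 ≤ (shiftedLap G)⁻¹ i i * (shiftedLap G)⁻¹ i i := by
          rw [pow_two]
          exact mul_self_le_mul_self (by positivity) (one_div_le_omega_self G i)
      _ ≤ _ := Finset.single_le_sum (f := fun j => (shiftedLap G)⁻¹ i j * (shiftedLap G)⁻¹ i j)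
          (fun j _ => mul_self_nonneg _) (Finset.mem_univ i)
  have hsketch (j : Fin n) (r : Fin p) : equilibrium G (τ.1 r) j = τ.1 r ⬝ᵥ (shiftedLap G)⁻¹ j :=
    dotProduct_comm ((shiftedLap G)⁻¹ j) (τ.1 r)
  rw [add_mul]
  exact abs_sum_sq_sub_le hn hε hε2 δ.pos₂.le δ.le₂ hcalls le_one
    (fun j => by simpa only [hsketch] using! hP j) le_rfl hdiag

lemma abs_sum_sq_solveX_sub_le (hn : 0 < n) (hε : 0 ≤ ε) (hε2 : ε ≤ 1 / 2)
    (hτ : RoundOK E edges δ s r₀ τ) (i : Fin n) :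
    |∑ r, (solveX E edges δ τ r).val i ^ 2 -
        (incidence edges *ᵥ (shiftedLap G)⁻¹ i) ⬝ᵥ (incidence edges *ᵥ (shiftedLap G)⁻¹ i)| ≤
      ε / 12 *
          ((incidence edges *ᵥ (shiftedLap G)⁻¹ i) ⬝ᵥ (incidence edges *ᵥ (shiftedLap G)⁻¹ i)) +
        ε / 14 * (shiftedLap G)⁻¹ i i := by
  obtain ⟨-, hQ, hcalls, -⟩ := hτ
  have le_diag (j : Fin n) :
      (incidence edges *ᵥ (shiftedLap G)⁻¹ j) ⬝ᵥ (incidence edges *ᵥ (shiftedLap G)⁻¹ j) ≤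
        (shiftedLap G)⁻¹ j j := by
    linarith [omega_self_eq edges j, dotProduct_self_nonneg ((shiftedLap G)⁻¹ j)]
  have hdiag : (1 / ((n : ℝ) + 1)) ^ 2 ≤ (shiftedLap G)⁻¹ i i :=
    (pow_le_of_le_one (by positivity) (by rw [div_le_one (by positivity)]; linarith)
      two_ne_zero).trans (one_div_le_omega_self G i)
  have hsketch (j : Fin n) (r : Fin p) : equilibrium G (τ.2.1 r ᵥ* incidence edges) j =
      τ.2.1 r ⬝ᵥ (incidence edges *ᵥ (shiftedLap G)⁻¹ j) := by
    rw [Matrix.dotProduct_mulVec, dotProduct_comm]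
    rfl
  exact abs_sum_sq_sub_le hn hε hε2 δ.pos₁.le (δ.le₁.trans (delta₁Bound_le_delta₂Bound hn hε))
    hcalls (fun j => (le_diag j).trans (omega_le_one G j j))
    (fun j => by simpa only [hsketch] using! hQ j) (le_diag i) hdiag

lemma abs_estimateDelta_sub_gain_le (hr : (r₀ : ℕ) + 1 = p) (hn : 2 ≤ n) (hG : G.Connected)
    (hε : 0 ≤ ε) (hε2 : ε ≤ 1 / 2) (hs : 0 ≤ s) (hτ : RoundOK E edges δ s r₀ τ) (i : Fin n) :
    |(estimateDelta E o edges δ p s τ).val i - gain (conflictMatrix G o) s i| ≤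
      ε / 2 * gain (conflictMatrix G o) s i := by
  have hM0 := conflictMatrix_nonneg (G := G) o
  have hY := abs_sum_sq_solveY_sub_le (by omega) hε hε2 hτ i
  have of_error {c c' : ℝ} (hc : 0 ≤ c) (hc' : 0 ≤ c') (hsum : 2 * c + c' ≤ ε / 2)
      (hpot : |potentialEst E o δ s τ r₀ i - (conflictMatrix G o *ᵥ s) i| ≤
        c * (conflictMatrix G o *ᵥ s) i)
      (hdiag : |diagEst E o edges δ τ i - conflictMatrix G o i i| ≤
        c' * conflictMatrix G o i i) :
      |(estimateDelta E o edges δ p s τ).val i - gain (conflictMatrix G o) s i| ≤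
        ε / 2 * gain (conflictMatrix G o) s i := by
    rw [val_estimateDelta E o edges δ s τ hr]
    exact (abs_gain_error_le (hs i) (diag_mul_le_mulVec hM0 hs i) hc hc' hpot hdiag).trans
      (mul_le_mul_of_nonneg_right hsum (gain_nonneg hM0 hs i))
  cases o with
  | resistance =>
    refine of_error (c := ε / 12) (c' := ε / 12 + ε / 14 + ε / 14) (by positivity) (by positivity)
      (by linarith) (abs_solveQ_sub_le hn hG hε hs hτ i) ?_
    have hX := abs_sum_sq_solveX_sub_le (by omega) hε hε2 hτ i
    have hself := omega_self_eq edges i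
    have hB := dotProduct_self_nonneg (incidence edges *ᵥ (shiftedLap G)⁻¹ i)
    simp only [diagEst, conflictMatrix]
    rw [abs_le] at hX hY ⊢
    constructor <;> nlinarith
  | controversy =>
    have hMii : conflictMatrix G .controversy i i = (shiftedLap G)⁻¹ i ⬝ᵥ (shiftedLap G)⁻¹ i := by
      simp only [conflictMatrix, Matrix.mul_apply, dotProduct, (isSymm_omega G).apply i]
    have hMs : conflictMatrix G .controversy *ᵥ s = equilibrium G (equilibrium G s) :=
      (Matrix.mulVec_mulVec _ _ _).symm
    refine of_error (c := ε / 6 + ε / 288) (c' := ε / 12 + ε / 14) (by positivity) (by positivity)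
      (by linarith) ?_ ?_
    · rw [hMs]
      exact abs_solveH_sub_le hn hG hε hε2 hs hτ i
    · rw [hMii]
      exact hY

end Accuracy

/-! ### Rounds of Greedy-AC -/

section Rounds

variable {n m : ℕ} {G : SimpleGraph (Fin n)} [DecidableRel G.Adj] {ε : ℝ} (E : Estimator.{u})
  (κ : Sketch) (o : Objective) (tie : Finset (Fin n) → Fin n → Fin n → Bool)
  (edges : EdgeList G m) (δ : Precision G ε) (s : Fin n → ℝ)

/-- One round of Greedy-AC: the body of the loop of `greedyAC`, acting on the current set and the
current internal opinions. -/
def roundStep (ω : RoundTape n m (sketchDim n ε) E.Seed) (st : Finset (Fin n) × (Fin n → ℝ)) :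
    Timed (Finset (Fin n) × (Fin n → ℝ)) := do
  let (T, s) := st
  let d ← estimateDelta E o edges δ (sketchDim n ε) s ω
  let best ← argmaxOutside tie T d
  match best with
  | none => pure (T, s)
  | some i => do
    let T ← Timed.op (insert i T)
    let s ← Timed.op (Function.update s i 0)
    pure (T, s)

lemma val_greedyAC (k : ℕ) (τ : Fin k → RoundTape n m (sketchDim n ε) E.Seed) :
    (greedyAC E o tie edges δ s k τ).val =
      (Timed.loop k (fun t => roundStep E o tie edges δ (τ t)) (∅, s)).val.1 := rfl

lemma steps_greedyAC (k : ℕ) (τ : Fin k → RoundTape n m (sketchDim n ε) E.Seed) :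
    (greedyAC E o tie edges δ s k τ).steps =
      2 * n + (Timed.loop k (fun t => roundStep E o tie edges δ (τ t)) (∅, s)).steps := rfl

lemma tapeLaw_eq_pi_roundLaw (p k : ℕ) :
    tapeLaw E κ n m p k = Measure.pi fun _ : Fin k => roundLaw E κ n m p := rfl

variable {E o tie edges δ s} in
lemma val_roundStep {ω : RoundTape n m (sketchDim n ε) E.Seed} {T : Finset (Fin n)} {i : Fin n}
    (h : (argmaxOutside tie T (estimateDelta E o edges δ (sketchDim n ε) s ω).val).val = some i) :
    (roundStep E o tie edges δ ω (T, s)).val = (insert i T, Function.update s i 0) := by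
  simp only [roundStep, Timed.val_bind, h, Timed.val_op, Timed.val_pure]

lemma steps_roundStep_le (ω : RoundTape n m (sketchDim n ε) E.Seed)
    (st : Finset (Fin n) × (Fin n → ℝ)) :
    (roundStep E o tie edges δ ω st).steps ≤
      7 * n + 2 + (estimateDelta E o edges δ (sketchDim n ε) st.2 ω).steps := by
  have h := steps_argmaxOutside_le tie st.1 (estimateDelta E o edges δ (sketchDim n ε) st.2 ω).val
  simp only [roundStep, Timed.steps_bind]
  split <;> simp only [Timed.steps_bind, Timed.steps_op, Timed.steps_pure] <;> omega

end Rounds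

/-! ### Approximation guarantee -/

lemma one_sub_mul_le_of_estimates {ε a b a' b' : ℝ} (hε : 0 ≤ ε) (hb : 0 ≤ b)
    (ha' : |a' - a| ≤ ε / 2 * a) (hb' : |b' - b| ≤ ε / 2 * b) (h : b' ≤ a') :
    (1 - ε) * b ≤ a := by
  have hcompare : (1 - ε / 2) * b ≤ (1 + ε / 2) * a := by
    linarith [(abs_le.mp ha').2, (abs_le.mp hb').1]
  have hfactor : (1 + ε / 2) * ((1 - ε) * b) ≤ (1 - ε / 2) * b := by
    nlinarith [mul_nonneg (sq_nonneg ε) hb]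
  exact le_of_mul_le_mul_left (hfactor.trans hcompare) (by linarith)

lemma one_sub_one_div_le_pow {n k : ℕ} (hn : 0 < n) (hk : k ≤ n) :
    1 - 1 / (n : ℝ) ≤ (1 - 1 / (n : ℝ) ^ 2) ^ k := by
  have hn' : (1 : ℝ) ≤ n := by exact_mod_cast hn
  have hsq : 1 / (n : ℝ) ^ 2 ≤ 1 := div_le_one_of_le₀ (one_le_pow₀ hn') (by positivity)
  calc 1 - 1 / (n : ℝ) = 1 + n * -(1 / (n : ℝ) ^ 2) := by field_simp; ring
    _ ≤ 1 + k * -(1 / (n : ℝ) ^ 2) := by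
        have : (k : ℝ) ≤ n := by exact_mod_cast hk
        nlinarith [show 0 ≤ 1 / (n : ℝ) ^ 2 by positivity]
    _ ≤ (1 - 1 / (n : ℝ) ^ 2) ^ k := by
        rw [sub_eq_add_neg]
        exact one_add_mul_le_pow (by linarith) k

section Approximation

variable {n m : ℕ} {G : SimpleGraph (Fin n)} [DecidableRel G.Adj] {ε : ℝ} {E : Estimator.{u}}
  {κ : Sketch} {o : Objective} {tie : Finset (Fin n) → Fin n → Fin n → Bool}
  {edges : EdgeList G m} {δ : Precision G ε} {s : Fin n → ℝ} {k : ℕ}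

lemma exists_val_roundStep_eq (hn : 2 ≤ n) (hG : G.Connected) (hε : 0 ≤ ε) (hε2 : ε ≤ 1 / 2)
    (hs : 0 ≤ s) (hk : 0 < k) {T U : Finset (Fin n)} (hT : T.card < n) (hU : U.card ≤ k)
    {r₀ : Fin (sketchDim n ε)} (hr : (r₀ : ℕ) + 1 = sketchDim n ε)
    {ω : RoundTape n m (sketchDim n ε) E.Seed} (hω : RoundOK E edges δ (zeroOn T s) r₀ ω) :
    ∃ i ∉ T, (roundStep E o tie edges δ ω (T, zeroOn T s)).val =
        (insert i T, zeroOn (insert i T) s) ∧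
      objective G o s (insert i T) - objective G o s U ≤
        (1 - (1 - ε) / k) * (objective G o s T - objective G o s U) := by
  have hM0 := conflictMatrix_nonneg (G := G) o
  obtain ⟨i, hi, hiT, hmax⟩ := exists_val_argmaxOutside_eq_some tie
    (estimateDelta E o edges δ (sketchDim n ε) (zeroOn T s) ω).val hT
  refine ⟨i, hiT, (val_roundStep hi).trans (by rw [zeroOn_insert]), ?_⟩
  simp only [objective_eq_quad]
  refine quad_insert_sub_le (isSymm_conflictMatrix G o) hM0 hs hk (by linarith) hU fun j hj => ?_
  have hT0 := zeroOn_nonneg hs T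
  have haccurate := abs_estimateDelta_sub_gain_le (o := o) hr hn hG hε hε2 hT0 hω
  exact one_sub_mul_le_of_estimates hε (gain_nonneg hM0 hT0 j) (haccurate i) (haccurate j)
    (hmax j hj)

variable (G o s k ε) in
/-- The invariant of the loop of `greedyAC` after `j` successful rounds: the gap to the value of `U`
has shrunk geometrically. -/
def IsGreedyState (U : Finset (Fin n)) (j : ℕ) (st : Finset (Fin n) × (Fin n → ℝ)) : Prop :=
  st.1.card = j ∧ st.2 = zeroOn st.1 s ∧
    objective G o s st.1 - objective G o s U ≤
      (1 - (1 - ε) / k) ^ j * (objective G o s ∅ - objective G o s U)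

lemma isGreedyState_empty (U : Finset (Fin n)) : IsGreedyState G ε o s k U 0 (∅, s) :=
  ⟨rfl, (zeroOn_empty s).symm, by rw [pow_zero, one_mul]⟩

lemma IsGreedyState.roundStep (hn : 2 ≤ n) (hkn : k ≤ n) (hG : G.Connected) (hε : 0 ≤ ε)
    (hε2 : ε ≤ 1 / 2) (hs : 0 ≤ s) {U : Finset (Fin n)} (hU : U.card ≤ k)
    {r₀ : Fin (sketchDim n ε)} (hr : (r₀ : ℕ) + 1 = sketchDim n ε) {j : ℕ} (hj : j < k)
    {st : Finset (Fin n) × (Fin n → ℝ)} (hst : IsGreedyState G ε o s k U j st)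
    {ω : RoundTape n m (sketchDim n ε) E.Seed} (hω : RoundOK E edges δ st.2 r₀ ω) :
    IsGreedyState G ε o s k U (j + 1) (roundStep E o tie edges δ ω st).val := by
  obtain ⟨T, s'⟩ := st
  obtain ⟨rfl, rfl, hgap⟩ : T.card = j ∧ s' = zeroOn T s ∧ _ := hst
  obtain ⟨i, hiT, hval, hprogress⟩ := exists_val_roundStep_eq (o := o) (tie := tie) hn hG hε hε2 hs
    (by omega) (by omega : T.card < n) hU hr hω
  rw [hval]
  refine ⟨Finset.card_insert_of_notMem hiT, rfl, hprogress.trans ?_⟩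
  rw [pow_succ', mul_assoc]
  have hk : (1 : ℝ) ≤ k := by exact_mod_cast Nat.one_le_of_lt hj
  have hfactor : (1 - ε) / k ≤ 1 := by
    rw [div_le_one (by linarith)]
    linarith
  exact mul_le_mul_of_nonneg_left hgap (sub_nonneg.mpr hfactor)

lemma objective_le_objective_empty (hs : 0 ≤ s) (U : Finset (Fin n)) :
    objective G o s U ≤ objective G o s ∅ := by
  simp only [objective_eq_quad]
  exact quad_le_quad (conflictMatrix_nonneg o) (zeroOn_nonneg hs U)
    (zeroOn_le_of_subset hs (Finset.empty_subset U))

lemma IsGreedyState.mul_le_objective_sub (hs : 0 ≤ s) (hε : 0 ≤ ε) (hε2 : ε ≤ 1 / 2)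
    {U : Finset (Fin n)} (hU : U.card ≤ k) {st : Finset (Fin n) × (Fin n → ℝ)}
    (hst : IsGreedyState G ε o s k U k st) :
    (1 - 1 / Real.exp 1 - ε) * (objective G o s ∅ - objective G o s U) ≤
      objective G o s ∅ - objective G o s st.1 := by
  rcases Nat.eq_zero_or_pos k with rfl | hk
  · obtain rfl : U = ∅ := Finset.card_eq_zero.mp (by omega)
    rw [Finset.card_eq_zero.mp hst.1, sub_self, mul_zero]
  · have hgap := hst.2.2.trans (mul_le_mul_of_nonneg_right (greedy_factor_le hk hε hε2)
      (sub_nonneg.mpr (objective_le_objective_empty hs U)))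
    linarith

variable (E κ o tie edges δ) in
lemma le_measure_isGreedyState (hn : 2 ≤ n) (hkn : k ≤ n) (hG : G.Connected) (hε : 0 < ε)
    (hε2 : ε ≤ 1 / 2) (hs : 0 ≤ s) {η : ℕ → ℝ} (hE : E.Reliable η) {U : Finset (Fin n)}
    (hU : U.card ≤ k) :
    (ENNReal.ofReal (1 - 1 / (n : ℝ) ^ 2) *
        ENNReal.ofReal (1 - η n) ^ (2 * sketchDim n ε + 2)) ^ k ≤
      tapeLaw E κ n m (sketchDim n ε) k {τ | IsGreedyState G ε o s k U k
        (Timed.loop k (fun t => roundStep E o tie edges δ (τ t)) (∅, s)).val} := by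
  have hpos := sketchDim_pos hn hε
  let r₀ : Fin (sketchDim n ε) := ⟨sketchDim n ε - 1, by omega⟩
  exact pow_le_measure_loop (step := roundStep E o tie edges δ)
    (Good := fun st => {ω | RoundOK E edges δ st.2 r₀ ω})
    (fun st => measurableSet_roundOK E edges δ st.2 r₀)
    (fun _ st _ _ => le_measure_roundOK κ edges δ st.2 hn hε hε2 hE r₀)
    (fun _ _ _ hj hst hω => hst.roundStep hn hkn hG hε.le hε2 hs hU (Nat.sub_add_cancel hpos) hj hω)
    (zero_add k) (isGreedyState_empty U)

variable (κ o tie edges δ) in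
theorem le_measureReal_greedyAC (hn : 2 ≤ n) (hkn : k ≤ n) (hG : G.Connected) (hε : 0 < ε)
    (hε2 : ε ≤ 1 / 2) (hs : 0 ≤ s) {η : ℕ → ℝ} (hE : E.Reliable η) (hη : η n ≤ 1)
    {U : Finset (Fin n)} (hU : U.card ≤ k) :
    (1 - 1 / (n : ℝ)) * (1 - η n) ^ ((2 * sketchDim n ε + 2) * k) ≤
      (tapeLaw E κ n m (sketchDim n ε) k).real
        {τ | (greedyAC E o tie edges δ s k τ).val.card = k ∧
          (1 - 1 / Real.exp 1 - ε) * (objective G o s ∅ - objective G o s U) ≤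
            objective G o s ∅ - objective G o s (greedyAC E o tie edges δ s k τ).val} := by
  have : IsProbabilityMeasure (tapeLaw E κ n m (sketchDim n ε) k) := by
    rw [tapeLaw_eq_pi_roundLaw]
    infer_instance
  have hn0 : (0 : ℝ) ≤ 1 - 1 / (n : ℝ) ^ 2 :=
    sub_nonneg.mpr (div_le_one_of_le₀ (one_le_pow₀ (by exact_mod_cast (by omega : 1 ≤ n)))
      (by positivity))
  refine (ENNReal.ofReal_le_iff_le_toReal (measure_ne_top _ _)).mp ?_
  calc ENNReal.ofReal ((1 - 1 / (n : ℝ)) * (1 - η n) ^ ((2 * sketchDim n ε + 2) * k))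
      ≤ ENNReal.ofReal (((1 - 1 / (n : ℝ) ^ 2) * (1 - η n) ^ (2 * sketchDim n ε + 2)) ^ k) := by
        rw [mul_pow, ← pow_mul]
        have := one_sub_one_div_le_pow (by omega) hkn
        have := sub_nonneg.mpr hη
        gcongr
    _ = (ENNReal.ofReal (1 - 1 / (n : ℝ) ^ 2) *
          ENNReal.ofReal (1 - η n) ^ (2 * sketchDim n ε + 2)) ^ k := by
        have := sub_nonneg.mpr hη
        rw [ENNReal.ofReal_pow (by positivity), ENNReal.ofReal_mul hn0,
          ENNReal.ofReal_pow this]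
    _ ≤ _ := le_measure_isGreedyState E κ o tie edges δ hn hkn hG hε hε2 hs hE hU
    _ ≤ tapeLaw E κ n m (sketchDim n ε) k
          {τ | (greedyAC E o tie edges δ s k τ).val.card = k ∧
            (1 - 1 / Real.exp 1 - ε) * (objective G o s ∅ - objective G o s U) ≤
              objective G o s ∅ - objective G o s (greedyAC E o tie edges δ s k τ).val} :=
        measure_mono fun τ hτ => by
          simp only [Set.mem_ofPred_eq, val_greedyAC]
          exact ⟨hτ.1, hτ.mul_le_objective_sub hs hε.le hε2 hU⟩

end Approximation

/-! ### Running time -/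

section Calls

variable {n : ℕ} {E : Estimator.{u}} {ι : Type*} [Fintype ι]

variable (E) in
lemma measurable_steps_run {Ω : Type*} [MeasurableSpace Ω] (S : Matrix (Fin n) (Fin n) ℝ)
    {b : Ω → Fin n → ℝ} (hb : Measurable b) (d : ℝ) {seed : Ω → E.Seed} (hseed : Measurable seed) :
    Measurable fun ω => ((E.run S (b ω) d (seed ω)).steps : ℝ≥0∞) :=
  (measurable_of_countable _).comp ((E.measurable_steps S d).comp (hb.prodMk hseed))

lemma lintegral_pi_eval {Ω : Type*} [MeasurableSpace Ω] (μ : Measure Ω) [IsProbabilityMeasure μ]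
    (i : ι) {g : Ω → ℝ≥0∞} (hg : Measurable g) :
    ∫⁻ σ, g (σ i) ∂(Measure.pi fun _ : ι => μ) = ∫⁻ ω, g ω ∂μ :=
  (measurePreserving_eval (fun _ : ι => μ) i).lintegral_comp hg

variable {A : ℝ} {a : ℕ} {S : Matrix (Fin n) (Fin n) ℝ} {d : ℝ}

lemma Estimator.NearlyLinear.lintegral_steps_le (hE : E.NearlyLinear A a) (hn : 2 ≤ n)
    (hS : IsSDDM S) (b : Fin n → ℝ) (hd : 0 < d) (i : ι) :
    ∫⁻ σ, ((E.run S b d (σ i)).steps : ℝ≥0∞) ∂(Measure.pi fun _ : ι => E.seedLaw) ≤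
      ENNReal.ofReal (A * nnz S * Real.log n ^ a) :=
  (lintegral_pi_eval E.seedLaw i
    (measurable_steps_run E S measurable_const d measurable_id)).trans_le (hE n S b d hn hS hd)

lemma Estimator.NearlyLinear.lintegral_steps_comp_le (hE : E.NearlyLinear A a) (hn : 2 ≤ n)
    (hS : IsSDDM S) (b : Fin n → ℝ) (d' : ℝ) (hd : 0 < d) {k : ℕ} (i : Fin k) :
    ∫⁻ σ, ((E.run S (E.run S b d' (σ 0)).val d (σ i.succ)).steps : ℝ≥0∞)
        ∂(Measure.pi fun _ : Fin (k + 1) => E.seedLaw) ≤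
      ENNReal.ofReal (A * nnz S * Real.log n ^ a) :=
  calc ∫⁻ σ, ((E.run S (E.run S b d' (σ 0)).val d (σ i.succ)).steps : ℝ≥0∞)
        ∂(Measure.pi fun _ : Fin (k + 1) => E.seedLaw)
      ≤ ∫⁻ ω, ∫⁻ σ, ((E.run S (E.run S b d' ω).val d (σ i)).steps : ℝ≥0∞)
          ∂(Measure.pi fun _ : Fin k => E.seedLaw) ∂E.seedLaw := lintegral_pi_succ_le _
    _ ≤ ∫⁻ _ω, ENNReal.ofReal (A * nnz S * Real.log n ^ a) ∂E.seedLaw :=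
        lintegral_mono fun _ => hE.lintegral_steps_le hn hS _ hd i
    _ = ENNReal.ofReal (A * nnz S * Real.log n ^ a) := by
        rw [lintegral_const, measure_univ, mul_one]

end Calls

section Rounds

variable {n m p : ℕ} {G : SimpleGraph (Fin n)} [DecidableRel G.Adj] {ε : ℝ} {E : Estimator.{u}}
  (κ : Sketch) (o : Objective) (tie : Finset (Fin n) → Fin n → Fin n → Bool)
  (edges : EdgeList G m) (δ : Precision G ε) (s : Fin n → ℝ) {A : ℝ} {a : ℕ}

lemma lintegral_roundLaw_le {f : RoundTape n m p E.Seed → ℝ≥0∞} {K : ℝ≥0∞}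
    (h : ∀ P Q, ∫⁻ σ, f (P, Q, σ)
      ∂(Measure.pi fun _ : Fin p => Measure.pi fun _ : Fin 4 => E.seedLaw) ≤ K) :
    ∫⁻ τ, f τ ∂(roundLaw E κ n m p) ≤ K := by
  refine (lintegral_prod_le _).trans (lintegral_le_const (.of_forall fun P => ?_))
  exact (lintegral_prod_le _).trans (lintegral_le_const (.of_forall fun Q => h P Q))

variable (E) (r : Fin p)

lemma measurable_steps_solveQ :
    Measurable fun τ : RoundTape n m p E.Seed => ((solveQ E δ s τ r).steps : ℝ≥0∞) :=
  measurable_steps_run E _ measurable_const _ (measurable_seed E r 0)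

lemma measurable_steps_solveH :
    Measurable fun τ : RoundTape n m p E.Seed => ((solveH E δ s τ r).steps : ℝ≥0∞) :=
  measurable_steps_run E _ (measurable_val_run E _ _ _ (measurable_seed E r 0)) _
    (measurable_seed E r 1)

lemma measurable_steps_solveX :
    Measurable fun τ : RoundTape n m p E.Seed => ((solveX E edges δ τ r).steps : ℝ≥0∞) :=
  measurable_steps_run E _ ((continuous_id.matrix_vecMul continuous_const).measurable.comp
    (show Measurable fun τ : RoundTape n m p E.Seed => τ.2.1 r by fun_prop)) _
    (measurable_seed E r 2)

lemma measurable_steps_solveY :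
    Measurable fun τ : RoundTape n m p E.Seed => ((solveY E δ τ r).steps : ℝ≥0∞) :=
  measurable_steps_run E _ (by fun_prop) _ (measurable_seed E r 3)

variable {E}

lemma lintegral_steps_solveQ_le (hn : 2 ≤ n) (hE : E.NearlyLinear A a) :
    ∫⁻ τ, ((solveQ E δ s τ r).steps : ℝ≥0∞) ∂(roundLaw E κ n m p) ≤
      ENNReal.ofReal (A * nnz (shiftedLap G) * Real.log n ^ a) :=
  lintegral_roundLaw_le κ fun _ _ => (lintegral_pi_eval _ r
    (measurable_steps_run E _ measurable_const _ (measurable_pi_apply 0))).trans_le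
      (hE.lintegral_steps_le hn (isSDDM_shiftedLap G) s δ.pos₃ (0 : Fin 4))

lemma lintegral_steps_solveH_le (hn : 2 ≤ n) (hE : E.NearlyLinear A a) :
    ∫⁻ τ, ((solveH E δ s τ r).steps : ℝ≥0∞) ∂(roundLaw E κ n m p) ≤
      ENNReal.ofReal (A * nnz (shiftedLap G) * Real.log n ^ a) :=
  lintegral_roundLaw_le κ fun _ _ => (lintegral_pi_eval _ r (measurable_steps_run E _
    (measurable_val_run E _ _ _ (measurable_pi_apply 0)) _ (measurable_pi_apply 1))).trans_le
      (hE.lintegral_steps_comp_le hn (isSDDM_shiftedLap G) s _ δ.pos₃ (0 : Fin 3))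

lemma lintegral_steps_solveX_le (hn : 2 ≤ n) (hE : E.NearlyLinear A a) :
    ∫⁻ τ, ((solveX E edges δ τ r).steps : ℝ≥0∞) ∂(roundLaw E κ n m p) ≤
      ENNReal.ofReal (A * nnz (shiftedLap G) * Real.log n ^ a) :=
  lintegral_roundLaw_le κ fun _ Q => (lintegral_pi_eval _ r
    (measurable_steps_run E _ measurable_const _ (measurable_pi_apply 2))).trans_le
      (hE.lintegral_steps_le hn (isSDDM_shiftedLap G) (Q r ᵥ* incidence edges) δ.pos₁ (2 : Fin 4))

lemma lintegral_steps_solveY_le (hn : 2 ≤ n) (hE : E.NearlyLinear A a) :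
    ∫⁻ τ, ((solveY E δ τ r).steps : ℝ≥0∞) ∂(roundLaw E κ n m p) ≤
      ENNReal.ofReal (A * nnz (shiftedLap G) * Real.log n ^ a) :=
  lintegral_roundLaw_le κ fun P _ => (lintegral_pi_eval _ r
    (measurable_steps_run E _ measurable_const _ (measurable_pi_apply 3))).trans_le
      (hE.lintegral_steps_le hn (isSDDM_shiftedLap G) (P r) δ.pos₂ (3 : Fin 4))

lemma measurable_solveSteps :
    Measurable fun τ : RoundTape n m p E.Seed => (solveSteps E edges δ s τ r : ℝ≥0∞) := by
  simp only [solveSteps, Nat.cast_add]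
  exact (((measurable_steps_solveQ E δ s r).add (measurable_steps_solveH E δ s r)).add
    (measurable_steps_solveX E edges δ r)).add (measurable_steps_solveY E δ r)

lemma lintegral_solveSteps_le (hn : 2 ≤ n) (hE : E.NearlyLinear A a) :
    ∫⁻ τ, (solveSteps E edges δ s τ r : ℝ≥0∞) ∂(roundLaw E κ n m p) ≤
      4 * ENNReal.ofReal (A * nnz (shiftedLap G) * Real.log n ^ a) := by
  simp only [solveSteps, Nat.cast_add]
  rw [lintegral_add_right _ (measurable_steps_solveY E δ r),
    lintegral_add_right _ (measurable_steps_solveX E edges δ r),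
    lintegral_add_right _ (measurable_steps_solveH E δ s r)]
  refine (add_le_add (add_le_add (add_le_add (lintegral_steps_solveQ_le κ δ s r hn hE)
    (lintegral_steps_solveH_le κ δ s r hn hE)) (lintegral_steps_solveX_le κ edges δ r hn hE))
    (lintegral_steps_solveY_le κ δ r hn hE)).trans_eq ?_
  ring

lemma lintegral_steps_estimateDelta_le (hn : 2 ≤ n) (hE : E.NearlyLinear A a) :
    ∫⁻ τ, ((estimateDelta E o edges δ p s τ).steps : ℝ≥0∞) ∂(roundLaw E κ n m p) ≤
      (4 + 18 * n + 13 * m + p * (20 * n + 10 * m + 4) : ℕ) +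
        p * (4 * ENNReal.ofReal (A * nnz (shiftedLap G) * Real.log n ^ a)) := by
  simp only [steps_estimateDelta, Nat.cast_add (4 + 18 * n + 13 * m + p * (20 * n + 10 * m + 4)),
    Nat.cast_sum]
  rw [lintegral_add_left measurable_const, lintegral_const, measure_univ, mul_one,
    lintegral_finsetSum _ fun r _ => measurable_solveSteps edges δ s r]
  gcongr
  refine (Finset.sum_le_card_nsmul _ _ _ fun r _ =>
    lintegral_solveSteps_le κ edges δ s r hn hE).trans_eq ?_
  rw [Finset.card_fin, nsmul_eq_mul]

lemma lintegral_steps_roundStep_le (hn : 2 ≤ n) (hE : E.NearlyLinear A a)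
    (st : Finset (Fin n) × (Fin n → ℝ)) :
    ∫⁻ ω, ((roundStep E o tie edges δ ω st).steps : ℝ≥0∞) ∂(roundLaw E κ n m (sketchDim n ε)) ≤
      (7 * n + 2 : ℕ) +
        ((4 + 18 * n + 13 * m + sketchDim n ε * (20 * n + 10 * m + 4) : ℕ) +
          sketchDim n ε * (4 * ENNReal.ofReal (A * nnz (shiftedLap G) * Real.log n ^ a))) :=
  calc ∫⁻ ω, ((roundStep E o tie edges δ ω st).steps : ℝ≥0∞) ∂(roundLaw E κ n m (sketchDim n ε))
      ≤ ∫⁻ ω, ((7 * n + 2 : ℕ) +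
          ((estimateDelta E o edges δ (sketchDim n ε) st.2 ω).steps : ℝ≥0∞))
            ∂(roundLaw E κ n m (sketchDim n ε)) :=
        lintegral_mono fun ω => by
          rw [← Nat.cast_add]
          exact Nat.cast_le.mpr (steps_roundStep_le E o tie edges δ ω st)
    _ = (7 * n + 2 : ℕ) + ∫⁻ ω, ((estimateDelta E o edges δ (sketchDim n ε) st.2 ω).steps : ℝ≥0∞)
          ∂(roundLaw E κ n m (sketchDim n ε)) := by
        rw [lintegral_add_left measurable_const, lintegral_const, measure_univ, mul_one]
    _ ≤ _ := by
        gcongr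
        exact lintegral_steps_estimateDelta_le κ o edges δ st.2 hn hE

lemma lintegral_steps_greedyAC_le (hn : 2 ≤ n) (hE : E.NearlyLinear A a) (k : ℕ) :
    ∫⁻ τ, ((greedyAC E o tie edges δ s k τ).steps : ℝ≥0∞)
        ∂(tapeLaw E κ n m (sketchDim n ε) k) ≤
      (2 * n : ℕ) + k * (1 + ((7 * n + 2 : ℕ) +
        ((4 + 18 * n + 13 * m + sketchDim n ε * (20 * n + 10 * m + 4) : ℕ) +
          sketchDim n ε * (4 * ENNReal.ofReal (A * nnz (shiftedLap G) * Real.log n ^ a))))) := by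
  simp only [steps_greedyAC, Nat.cast_add (2 * n)]
  rw [lintegral_add_left measurable_const, lintegral_const, tapeLaw_eq_pi_roundLaw, measure_univ,
    mul_one]
  gcongr
  exact lintegral_steps_loop_le (lintegral_steps_roundStep_le κ o tie edges δ hn hE) k (∅, s)

lemma greedy_step_count_le {n m p k : ℕ} (hnm : n ≤ 2 * m) (hm : 0 < m) (hp : 0 < p)
    (hk : 0 < k) :
    2 * n + k * (1 + (7 * n + 2 + (4 + 18 * n + 13 * m + p * (20 * n + 10 * m + 4)))) ≤
      k * m * p * 128 := by
  have m_le : m ≤ m * p := Nat.le_mul_of_pos_right m hp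
  have p_le : p ≤ m * p := Nat.le_mul_of_pos_left p hm
  have hround : 1 + (7 * n + 2 + (4 + 18 * n + 13 * m + p * (20 * n + 10 * m + 4))) ≤
      m * p * 124 := by nlinarith [Nat.mul_le_mul_right p hnm]
  have hinit : 2 * n ≤ k * (m * p * 4) :=
    (by omega : 2 * n ≤ m * p * 4).trans (Nat.le_mul_of_pos_left _ hk)
  calc _ ≤ k * (m * p * 4) + k * (m * p * 124) := by gcongr
    _ = k * m * p * 128 := by ring

lemma lintegral_steps_greedyAC_le_mul (hn : 2 ≤ n) (hG : G.Connected) (hε : 0 < ε)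
    (hE : E.NearlyLinear A a) {k : ℕ} (hk : 0 < k) :
    ∫⁻ τ, ((greedyAC E o tie edges δ s k τ).steps : ℝ≥0∞)
        ∂(tapeLaw E κ n m (sketchDim n ε) k) ≤
      ENNReal.ofReal (k * m * sketchDim n ε * (128 + 16 * |A| * Real.log n ^ a)) := by
  have hnm := edges.card_le_add_one hG
  set p := sketchDim n ε
  have hsteps : 2 * n + k * (1 + (7 * n + 2 + (4 + 18 * n + 13 * m + p * (20 * n + 10 * m + 4)))) ≤
      k * m * p * 128 :=
    greedy_step_count_le (by omega) (by omega) (sketchDim_pos hn hε) hk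
  have hsolve : A * nnz (shiftedLap G) * Real.log n ^ a ≤ |A| * (4 * m) * Real.log n ^ a := by
    have hnnz : (nnz (shiftedLap G) : ℝ) ≤ 4 * m := by
      exact_mod_cast (nnz_shiftedLap_le edges).trans (by omega)
    gcongr
    exact le_abs_self A
  have hsplit : ENNReal.ofReal (k * m * p * (16 * |A| * Real.log n ^ a)) =
      k * (p * (4 * ENNReal.ofReal (|A| * (4 * m) * Real.log n ^ a))) := by
    rw [show (k * m * p * (16 * |A| * Real.log n ^ a) : ℝ) =
        k * (p * (4 * (|A| * (4 * m) * Real.log n ^ a))) by ring,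
      ENNReal.ofReal_mul k.cast_nonneg, ENNReal.ofReal_mul p.cast_nonneg,
      ENNReal.ofReal_mul zero_le_four, ENNReal.ofReal_natCast, ENNReal.ofReal_natCast,
      ENNReal.ofReal_ofNat]
  refine (lintegral_steps_greedyAC_le κ o tie edges δ s hn hE k).trans ?_
  calc _ ≤ (2 * n : ℕ) + k * (1 + ((7 * n + 2 : ℕ) +
        ((4 + 18 * n + 13 * m + p * (20 * n + 10 * m + 4) : ℕ) +
          p * (4 * ENNReal.ofReal (|A| * (4 * m) * Real.log n ^ a))))) := by gcongr
    _ = (2 * n + k * (1 + (7 * n + 2 + (4 + 18 * n + 13 * m + p * (20 * n + 10 * m + 4)))) : ℕ) +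
          ENNReal.ofReal (k * m * p * (16 * |A| * Real.log n ^ a)) := by
        rw [hsplit]
        push_cast
        ring
    _ ≤ (k * m * p * 128 : ℕ) + ENNReal.ofReal (k * m * p * (16 * |A| * Real.log n ^ a)) := by
        gcongr
    _ = ENNReal.ofReal (k * m * p * (128 + 16 * |A| * Real.log n ^ a)) := by
        rw [← ENNReal.ofReal_natCast, ← ENNReal.ofReal_add (by positivity) (by positivity)]
        push_cast
        rw [mul_add]

lemma half_le_log (hn : 2 ≤ n) : 1 / 2 ≤ Real.log n := by
  have hlog : Real.log 2 ≤ Real.log n := Real.log_le_log two_pos (by exact_mod_cast hn)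
  linarith [Real.log_two_gt_d9]

lemma sketchDim_le (hn : 2 ≤ n) (hε : 0 < ε) (hε2 : ε ≤ 1 / 2) :
    (sketchDim n ε : ℝ) ≤ 3457 * (Real.log n * ε⁻¹ ^ 2) := by
  have hlog := half_le_log hn
  have two_le_inv : 2 ≤ ε⁻¹ := by
    rw [le_inv_comm₀ two_pos hε]
    linarith
  calc (sketchDim n ε : ℝ) ≤ 24 * Real.log n / (ε / 12) ^ 2 + 1 :=
        (Nat.ceil_lt_add_one (by positivity)).le
    _ = 3456 * (Real.log n * ε⁻¹ ^ 2) + 1 := by field_simp; ring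
    _ ≤ 3457 * (Real.log n * ε⁻¹ ^ 2) := by nlinarith

theorem lintegral_steps_greedyAC_le_ofReal (hn : 2 ≤ n) (hG : G.Connected) (hε : 0 < ε)
    (hε2 : ε ≤ 1 / 2) (hE : E.NearlyLinear A a) {k : ℕ} (hk : 0 < k) :
    ∫⁻ τ, ((greedyAC E o tie edges δ s k τ).steps : ℝ≥0∞)
        ∂(tapeLaw E κ n m (sketchDim n ε) k) ≤
      ENNReal.ofReal (3457 * (128 * 2 ^ a + 16 * |A|) * (m * k * ε⁻¹ ^ 2) *
        Real.log n ^ (a + 1)) := by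
  have one_le : 1 ≤ 2 ^ a * Real.log n ^ a := by
    rw [← mul_pow]
    exact one_le_pow₀ (by linarith [half_le_log hn])
  have hdim := sketchDim_le hn hε hε2
  refine (lintegral_steps_greedyAC_le_mul κ o tie edges δ s hn hG hε hE hk).trans
    (ENNReal.ofReal_le_ofReal ?_)
  calc k * m * sketchDim n ε * (128 + 16 * |A| * Real.log n ^ a)
      ≤ k * m * (3457 * (Real.log n * ε⁻¹ ^ 2)) *
          (128 * (2 ^ a * Real.log n ^ a) + 16 * |A| * Real.log n ^ a) := by
        gcongr
        linarith
    _ = 3457 * (128 * 2 ^ a + 16 * |A|) * (m * k * ε⁻¹ ^ 2) * Real.log n ^ (a + 1) := by ring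

end Rounds

end GreedyAC

end

open GreedyAC in
theorem mainTheorem1_general (A : ℝ) (a : ℕ) :
    ∃ (C : ℝ) (c : ℕ),
      ∀ (E : Estimator) (κ : Sketch) (o : Objective)
        (n m k : ℕ) (_ : 2 ≤ n) (_ : k ≤ n)
        (G : SimpleGraph (Fin n)) [DecidableRel G.Adj] (_ : G.Connected) (edges : EdgeList G m)
        (s : Fin n → ℝ) (_ : 0 ≤ s)
        (ε : ℝ) (_ : 0 < ε) (_ : ε ≤ 1 / 2) (δ : Precision G ε)
        (tie : Finset (Fin n) → Fin n → Fin n → Bool),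
        (∀ η : ℕ → ℝ, E.Reliable η → η n ≤ 1 → ∀ U : Finset (Fin n), U.card ≤ k →
          (1 - 1 / (n : ℝ)) * (1 - η n) ^ ((2 * sketchDim n ε + 2) * k) ≤
            (tapeLaw E κ n m (sketchDim n ε) k).real
              {τ | (greedyAC E o tie edges δ s k τ).val.card = k ∧
                (1 - 1 / Real.exp 1 - ε) * (objective G o s ∅ - objective G o s U) ≤
                  objective G o s ∅ - objective G o s (greedyAC E o tie edges δ s k τ).val}) ∧
        (E.NearlyLinear A a → 1 ≤ k →
          ∫⁻ τ, ((greedyAC E o tie edges δ s k τ).steps : ℝ≥0∞)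
              ∂(tapeLaw E κ n m (sketchDim n ε) k) ≤
            ENNReal.ofReal (C * (m * k * (ε⁻¹) ^ 2) * Real.log n ^ c)) := by
  refine ⟨3457 * (128 * 2 ^ a + 16 * |A|), a + 1, ?_⟩
  intro E κ o n m k hn hkn G _ hG edges s hs ε hε hε2 δ tie
  exact ⟨fun η hE hη U hU =>
      le_measureReal_greedyAC κ o tie edges δ hn hkn hG hε hε2 hs hE hη hU,
    fun hE hk => lintegral_steps_greedyAC_le_ofReal κ o tie edges δ s hn hG hε hε2 hE hk⟩

open GreedyAC in
theorem mainTheorem1 (A : ℝ) (a : ℕ) :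
    ∃ (C : ℝ) (c : ℕ),
      ∀ (E : Estimator) (κ : Sketch) (o : Objective)
        (n m k : ℕ) (_ : 2 ≤ n) (_ : k ≤ n)
        (G : SimpleGraph (Fin n)) [DecidableRel G.Adj] (_ : G.Connected) (edges : EdgeList G m)
        (s : Fin n → ℝ) (_ : ∀ i, s i ∈ Set.Icc (0 : ℝ) 1)
        (ε : ℝ) (_ : 0 < ε) (_ : ε ≤ 1 / 2) (δ : Precision G ε)
        (tie : Finset (Fin n) → Fin n → Fin n → Bool),
        (∀ η : ℕ → ℝ, E.Reliable η → η n ≤ 1 →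
          ∀ Topt : Finset (Fin n), IsOptimal (objective G o s) k Topt →
            (1 - 1 / (n : ℝ)) * (1 - η n) ^ ((2 * sketchDim n ε + 2) * k) ≤
              (tapeLaw E κ n m (sketchDim n ε) k).real
                {τ | (greedyAC E o tie edges δ s k τ).val.card = k ∧
                  (1 - 1 / Real.exp 1 - ε) * (objective G o s ∅ - objective G o s Topt) ≤
                    objective G o s ∅ -
                      objective G o s (greedyAC E o tie edges δ s k τ).val}) ∧
        (E.NearlyLinear A a → 1 ≤ k →
          ∫⁻ τ, ((greedyAC E o tie edges δ s k τ).steps : ℝ≥0∞)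
              ∂(tapeLaw E κ n m (sketchDim n ε) k) ≤
            ENNReal.ofReal (C * (m * k * (ε⁻¹) ^ 2) * Real.log n ^ c)) := by
  obtain ⟨C, c, h⟩ := mainTheorem1_general A a
  refine ⟨C, c, fun E κ o n m k hn hkn G _ hG edges s hs ε hε hε2 δ tie => ?_⟩
  obtain ⟨happrox, htime⟩ :=
    h E κ o n m k hn hkn G hG edges s (fun i => (hs i).1) ε hε hε2 δ tie
  exact ⟨fun η hE hη Topt hopt => happrox η hE hη Topt hopt.1.le, htime⟩
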